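/- **Setting.** Let $G$ be a two-player zero-sum simultaneous-move episodic Markov game with horizon $H\ge 1$, state space $\mathcal S$, finite action set $\mathcal A$ (for both players), $\mathcal Z=\mathcal S\times\mathcal A\times\mathcal A$, known rewards $r_h:\mathcal Z\to[-1,1]$ and discrete transition probabilities $\mathbb P_h(\cdot\mid z)$, $h\in[H]$. Let $\mathcal H$ be a real Hilbert space and $\phi(s'|z)\in\mathcal H$ a feature map such that for every $V:\mathcal S\to[-1,1]$ and $z\in\mathcal Z$ the sum $\phi_V(z)=\sum_{s'}V(s')\phi(s'|z)$ converges and $\|\phi_V(z)\|\le 1$. Assume the game is a kernel mixture game: $\mathbb P_h(s'|z)=\langle\phi(s'|z),\theta_h^*\rangle$ with unknown $\theta_h^*\in\mathcal H$, $\|\theta_h^*\|\le B$. Put $k_{V_1,V_2}(z_1,z_2)=\sum_{s_1,s_2}V_1(s_1)V_2(s_2)\langle\phi(s_1|z_1),\phi(s_2|z_2)\rangle$ (as an iterated sum) and $$\Gamma_K(T,\lambda)=\sup\tfrac12\log\det\Big(I+\tfrac1\lambda\big[k_{V_p,V_q}(z_p,z_q)\big]_{p,q=1}^T\Big),$$ the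 supremum over all $V_1,\dots,V_T:\mathcal S\to[-H,H]$ and $z_1,\dots,z_T\in\mathcal Z$. **Algorithm (KernelCCE-VTR).** Fix $T\ge1$, $\lambda=1+1/T$, $\beta>0$ and an initial state $x_1$. In episode $t=1,\dots,T$ put $\overline V_{H+1}^t=\underline V_{H+1}^t=0$ and for $h=H,\dots,1$: * $\overline\theta_h^t$ is the minimizer over $\theta\in\mathcal H$ of $\sum_{\tau<t}\big[\overline V_{h+1}^\tau(x_{h+1}^\tau)-\langle\phi_{\overline V_{h+1}^\tau}(z_h^\tau),\theta\rangle\big]^2+\lambda\|\theta\|^2$, and $\overline{\mathcal C}_h^t$ is the set of all $\theta$ with $\lambda\|\theta-\overline\theta_h^t\|^2+\sum_{\tau<t}\langle\phi_{\overline V_{h+1}^\tau}(z_h^\tau),\theta-\overline\theta_h^t\rangle^2\le\beta^2$; $\underline\theta_h^t$ and $\underline{\mathcal C}_h^t$ are defined in the same way from $\underline V$; * $\overline Q_h^t=\Pi_{[-H,H]}\big[r_h+\max_{\theta\in\overline{\mathcal C}_h^t}\langle\phi_{\overline V_{h+1}^t},\theta\rangle\big]$ and $\underline Q_h^t=\Pi_{[-H,H]}\big[r_h+\min_{\theta\in\underline{\mathcal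 C}_h^t}\langle\phi_{\underline V_{h+1}^t},\theta\rangle\big]$, where $\Pi_{[-H,H]}$ is the projection onto $[-H,H]$; * $\sigma_h^t(x)$ is a coarse correlated equilibrium of $(\overline Q_h^t,\underline Q_h^t)$ at $x$, that is, a distribution on $\mathcal A\times\mathcal A$ with $\mathbb E_{(a,b)\sim\sigma}\overline Q_h^t(x,a,b)\ge\mathbb E_{(a,b)\sim\sigma}\overline Q_h^t(x,a',b)$ and $\mathbb E_{(a,b)\sim\sigma}\underline Q_h^t(x,a,b)\le\mathbb E_{(a,b)\sim\sigma}\underline Q_h^t(x,a,b')$ for all $a',b'$, returned by a fixed routine; * $\overline V_h^t(x)=\mathbb E_{\sigma_h^t(x)}\overline Q_h^t(x,\cdot)$ and $\underline V_h^t(x)=\mathbb E_{\sigma_h^t(x)}\underline Q_h^t(x,\cdot)$. Then an episode is played from $x_1^t=x_1$ with $(a_h^t,b_h^t)\sim\sigma_h^t(x_h^t)$, $z_h^t=(x_h^t,a_h^t,b_h^t)$ and $x_{h+1}^t\sim\mathbb P_h(\cdot|z_h^t)$. Let $\pi_h^t,\nu_h^t$ be the first and second marginals of $\sigma_h^t$.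 Let $V_1^{\pi,\nu}(x)$ be the expected total reward of an episode started at $x$ in which the players act independently by the Markov policies $\pi,\nu$, and put $V_1^{*,\nu}=\sup_\pi V_1^{\pi,\nu}$, $V_1^{\pi,*}=\inf_\nu V_1^{\pi,\nu}$. A pair $(\pi,\nu)$ is an $\varepsilon$-approximate Nash equilibrium if $V_1^{*,\nu}(x_1)-V_1^{\pi,*}(x_1)\le\varepsilon$. **Statement.** For $\delta>0$ let $$L=2\,\Gamma_K(T,\lambda)+2+4\log(H/\delta)+2\lambda(B/H)^2 .$$ 1. There is an absolute constant $C>0$ such that for all $\varepsilon,\delta>0$: if $(\beta/H)^2\ge L$ and $T\ge C\,\beta^2H^2\,\Gamma_K(T,\lambda)/\varepsilon^2$, then with probability at least $1-\delta$ the pair $(\pi^{t_0},\nu^{t_0})$ is an $\varepsilon$-approximate Nash equilibrium for every $t_0\in\arg\min_{t\in[T]}\{\overline V_1^t(x_1)-\underline V_1^t(x_1)\}$. 2. For every $B$ there is a constant $C_B>0$, depending only on $B$, such that for all $\varepsilon,\delta>0$: if $(\beta/H)^2=L$ and $T\ge C_B\,(1+\log(H/\delta))\,H^4\,\Gamma_K(T,\lambda)^2/\varepsilon^2$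 (that is, $T=\tilde O(H^4\Gamma_K^2/\varepsilon^2)$ episodes suffice), then the same conclusion holds with probability at least $1-\delta$. -/

import Mathlib

open scoped InnerProductSpace

noncomputable section

namespace KernelGame

/-! ### Discrete expectations -/

/-- The expectation of `f` under the discrete distribution `p`. It is only used below for functions
that are bounded on the support of `p`, for which the sum converges absolutely. -/
def expect {α : Type*} (p : PMF α) (f : α → ℝ) : ℝ := ∑' a, (p a).toReal * f a

/-! ### Two-player zero-sum episodic Markov games

The `H` steps of an episode are indexed by `Fin H`; values have one more index, `Fin.last H`
being the end of the episode. -/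

/-- One step of play: the current state, the two actions, and the next state. -/
structure Step (S A : Type*) where
  state : S
  act₁ : A
  act₂ : A
  next : S

/-- The state-action triplet of a step. -/
def Step.triple {S A : Type*} (s : Step S A) : S × A × A := (s.state, s.act₁, s.act₂)

/-- The trajectory of one episode of `H` steps. -/
abbrev Episode (S A : Type*) (H : ℕ) := Fin H → Step S A

/-- A two-player zero-sum simultaneous-move episodic Markov game of horizon `H`. -/
structure MarkovGame (S A : Type*) (H : ℕ) where
  reward : Fin H → S × A × A → ℝ
  trans : Fin H → S × A × A → PMF S
  reward_mem : ∀ h z, reward h z ∈ Set.Icc (-1 : ℝ) 1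

/-- A Markov policy of one player. -/
abbrev Policy (S A : Type*) (H : ℕ) := Fin H → S → PMF A

/-- The law of the trajectory from state `x` when, at each step, the pair of actions is drawn from
the joint distribution `σ` at the current state and the next state from `P`. -/
def trajectoryLaw {S A : Type*} : {k : ℕ} → (σ : Fin k → S → PMF (A × A)) →
    (P : Fin k → S × A × A → PMF S) → (x : S) → PMF (Fin k → Step S A)
  | 0, _, _, _ => PMF.pure Fin.elim0
  | _ + 1, σ, P, x =>
      (σ 0 x).bind fun ab =>
        (P 0 (x, ab.1, ab.2)).bind fun y =>
          (trajectoryLaw (fun i => σ i.succ) (fun i => P i.succ) y).map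
            fun e => Fin.cons ⟨x, ab.1, ab.2, y⟩ e

/-- The joint action distribution of two players acting independently. -/
def independentPlay {S A : Type*} {H : ℕ} (π ν : Policy S A H) (h : Fin H) (x : S) :
    PMF (A × A) :=
  (π h x).bind fun a => (ν h x).map fun b => (a, b)

/-- The value `V₁^{π,ν}(x)`: the expected total reward of an episode started at `x`. -/
def policyValue {S A : Type*} {H : ℕ} (G : MarkovGame S A H) (π ν : Policy S A H) (x : S) : ℝ :=
  expect (trajectoryLaw (independentPlay π ν) G.trans x)
    fun e => ∑ h, G.reward h (e h).triple

/-- The value `V₁^{*,ν}(x)` of a best response of the max-player to `ν`. -/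
def bestMaxValue {S A : Type*} {H : ℕ} (G : MarkovGame S A H) (ν : Policy S A H) (x : S) : ℝ :=
  ⨆ π : Policy S A H, policyValue G π ν x

/-- The value `V₁^{π,*}(x)` of a best response of the min-player to `π`. -/
def bestMinValue {S A : Type*} {H : ℕ} (G : MarkovGame S A H) (π : Policy S A H) (x : S) : ℝ :=
  ⨅ ν : Policy S A H, policyValue G π ν x

/-- `(π, ν)` is an `ε`-approximate Nash equilibrium at the initial state `x`: its duality gap is at
most `ε`. -/
def IsApproxNash {S A : Type*} {H : ℕ} (G : MarkovGame S A H) (ε : ℝ) (π ν : Policy S A H)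
    (x : S) : Prop :=
  bestMaxValue G ν x - bestMinValue G π x ≤ ε

/-! ### Coarse correlated equilibria -/

/-- `σ` is a coarse correlated equilibrium at `x` of the payoffs `Q₁` (maximized by the first
player) and `Q₂` (minimized by the second player). -/
def IsCCE {S A : Type*} (Q₁ Q₂ : S × A × A → ℝ) (x : S) (σ : PMF (A × A)) : Prop :=
  (∀ a', expect (σ.map Prod.snd) (fun b => Q₁ (x, a', b)) ≤
      expect σ (fun p => Q₁ (x, p.1, p.2))) ∧
  (∀ b', expect σ (fun p => Q₂ (x, p.1, p.2)) ≤
      expect (σ.map Prod.fst) (fun a => Q₂ (x, a, b')))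

/-- The type of `FIND_CCE` routines: from two payoffs and a state to a joint distribution. -/
abbrev CCERoutine (S A : Type*) := (S × A × A → ℝ) → (S × A × A → ℝ) → S → PMF (A × A)

/-- The routine always returns a coarse correlated equilibrium. -/
def CCERoutine.Correct {S A : Type*} (F : CCERoutine S A) : Prop :=
  ∀ Q₁ Q₂ x, IsCCE Q₁ Q₂ x (F Q₁ Q₂ x)

/-! ### Kernel mixture games -/

section Kernel

variable {S A E : Type*} [NormedAddCommGroup E] [InnerProductSpace ℝ E]

/-- `φ_V(z) = ∑_{s'} V(s') φ(s'|z)`. -/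
def phiV (φ : S × A × A → S → E) (V : S → ℝ) (z : S × A × A) : E := ∑' s', V s' • φ z s'

/-- The weighted kernel function `k_{V₁,V₂}(z₁,z₂)`. -/
def weightedKernel (φ : S × A × A → S → E) (V₁ V₂ : S → ℝ) (z₁ z₂ : S × A × A) : ℝ :=
  ∑' s₁, ∑' s₂, V₁ s₁ * V₂ s₂ * ⟪φ z₁ s₁, φ z₂ s₂⟫_ℝ

/-- The feature map is normalized: for `V : S → [-1,1]` the sum `φ_V(z)` exists and has norm at
most one. (Summability is automatic when `S` is finite.) -/
def NormalizedFeature (φ : S × A × A → S → E) : Prop :=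
  ∀ V : S → ℝ, (∀ s, V s ∈ Set.Icc (-1 : ℝ) 1) → ∀ z,
    Summable (fun s' => V s' • φ z s') ∧ ‖phiV φ V z‖ ≤ 1

/-- The transition probabilities are `P_h(s'|z) = ⟨φ(s'|z), θ_h⟩`. -/
def IsKernelMixture {H : ℕ} (G : MarkovGame S A H) (φ : S × A × A → S → E)
    (θ : Fin H → E) : Prop :=
  ∀ h z s', (G.trans h z s').toReal = ⟪φ z s', θ h⟫_ℝ

/-- The effective dimension (maximal information gain) `Γ_K(T, lam)`: the supremum of
`(1/2) log det (I + K / lam)` over `V_i : S → [-H,H]` and triplets `z_i`, `1 ≤ i ≤ T`. -/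
def effDim (φ : S × A × A → S → E) (H T : ℕ) (lam : ℝ) : ℝ :=
  sSup {g : ℝ | ∃ (V : Fin T → S → ℝ) (z : Fin T → S × A × A),
    (∀ i s, V i s ∈ Set.Icc (-(H : ℝ)) H) ∧
    g = 1 / 2 * Real.log (Matrix.det ((1 : Matrix (Fin T) (Fin T) ℝ) +
      lam⁻¹ • Matrix.of fun p q => weightedKernel φ (V p) (V q) (z p) (z q)))}

/-! ### Kernel ridge regression and its confidence region -/

/-- The ridge loss of `θ` on a list of pairs (feature, target). -/
def ridgeLoss (lam : ℝ) (D : List (E × ℝ)) (θ : E) : ℝ :=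
  (D.map fun p => (p.2 - ⟪p.1, θ⟫_ℝ) ^ 2).sum + lam * ‖θ‖ ^ 2

/-- The minimizer of the ridge loss (it exists and is unique for `0 < lam`). -/
def ridgeEstimator (lam : ℝ) (D : List (E × ℝ)) : E :=
  Classical.epsilon fun θ => ∀ θ', ridgeLoss lam D θ ≤ ridgeLoss lam D θ'

/-- The confidence region of radius `β` around the ridge estimator. -/
def confidenceSet (lam β : ℝ) (D : List (E × ℝ)) : Set E :=
  {θ | Real.sqrt (lam * ‖θ - ridgeEstimator lam D‖ ^ 2 +
      (D.map fun p => ⟪p.1, θ - ridgeEstimator lam D⟫_ℝ ^ 2).sum) ≤ β}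

/-! ### The algorithm KernelCCE-VTR -/

/-- What the algorithm keeps of a past episode: its trajectory and the upper and lower value
estimates that were computed at its beginning. -/
structure Record (S A : Type*) (H : ℕ) where
  episode : Episode S A H
  upper : Fin (H + 1) → S → ℝ
  lower : Fin (H + 1) → S → ℝ

/-- What the algorithm is run with: known rewards, the feature map (used through its kernel only),
the regularization parameter, the bonus parameter and the `FIND_CCE` routine. The transition
probabilities are not part of it. -/
structure AlgInput (S A E : Type*) (H : ℕ) where
  reward : Fin H → S × A × A → ℝ
  feature : S × A × A → S → E
  lam : ℝ
  β : ℝ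
  findCCE : CCERoutine S A

variable {H : ℕ}

/-- The projection onto `[-H, H]`. -/
def clip (H : ℕ) (x : ℝ) : ℝ := max (-(H : ℝ)) (min (H : ℝ) x)

/-- The regression data for step `h`: each past episode contributes the feature `φ_V(z_h)` and the
target `V(x_{h+1})`, with `V` its own (upper or lower, according to `est`) estimate at `h + 1`. -/
def regressionData (I : AlgInput S A E H) (L : List (Record S A H))
    (est : Record S A H → Fin (H + 1) → S → ℝ) (h : Fin H) : List (E × ℝ) :=
  L.map fun R =>
    (phiV I.feature (est R h.succ) (R.episode h).triple, est R h.succ (R.episode h).next)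

/-- The optimistic action value at step `h`, given the upper value `V` at step `h + 1`. -/
def upperQ (I : AlgInput S A E H) (L : List (Record S A H)) (h : Fin H) (V : S → ℝ)
    (z : S × A × A) : ℝ :=
  clip H (I.reward h z + sSup ((fun θ => ⟪phiV I.feature V z, θ⟫_ℝ) ''
    confidenceSet I.lam I.β (regressionData I L Record.upper h)))

/-- The pessimistic action value at step `h`, given the lower value `V` at step `h + 1`. -/
def lowerQ (I : AlgInput S A E H) (L : List (Record S A H)) (h : Fin H) (V : S → ℝ)
    (z : S × A × A) : ℝ :=
  clip H (I.reward h z + sInf ((fun θ => ⟪phiV I.feature V z, θ⟫_ℝ) ''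
    confidenceSet I.lam I.β (regressionData I L Record.lower h)))

/-- The joint action distribution `σ_h` at step `h`, given the pair `W` of the upper and the lower
value at step `h + 1`. -/
def stepCCE (I : AlgInput S A E H) (L : List (Record S A H)) (h : Fin H)
    (W : (S → ℝ) × (S → ℝ)) (x : S) : PMF (A × A) :=
  I.findCCE (upperQ I L h W.1) (lowerQ I L h W.2) x

/-- The pair of the upper and the lower value estimates, by backward induction over the steps from
the value zero at the end of the episode. -/
def valuePair (I : AlgInput S A E H) (L : List (Record S A H)) :
    Fin (H + 1) → (S → ℝ) × (S → ℝ) :=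
  Fin.reverseInduction (motive := fun _ => (S → ℝ) × (S → ℝ)) (0, 0) fun h W =>
    (fun x => expect (stepCCE I L h W x) fun p => upperQ I L h W.1 (x, p.1, p.2),
     fun x => expect (stepCCE I L h W x) fun p => lowerQ I L h W.2 (x, p.1, p.2))

/-- The records of the past episodes. Lists of episodes have the most recent episode first; the
estimates recorded for an episode are computed from the episodes before it. -/
def records (I : AlgInput S A E H) : List (Episode S A H) → List (Record S A H)
  | [] => []
  | e :: past =>
      ⟨e, fun h => (valuePair I (records I past) h).1,
        fun h => (valuePair I (records I past) h).2⟩ :: records I past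

/-- The upper value estimate of the episode that follows the episodes `past`. -/
def upperV (I : AlgInput S A E H) (past : List (Episode S A H)) (h : Fin (H + 1)) : S → ℝ :=
  (valuePair I (records I past) h).1

/-- The lower value estimate of the episode that follows the episodes `past`. -/
def lowerV (I : AlgInput S A E H) (past : List (Episode S A H)) (h : Fin (H + 1)) : S → ℝ :=
  (valuePair I (records I past) h).2

/-- The joint action distribution `σ_h` used in the episode that follows the episodes `past`. -/
def jointPolicy (I : AlgInput S A E H) (past : List (Episode S A H)) (h : Fin H) :
    S → PMF (A × A) :=
  stepCCE I (records I past) h (valuePair I (records I past) h.succ)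

/-- The policy of the first player in the episode after `past`: the first marginal of `σ_h`. -/
def maxPolicy (I : AlgInput S A E H) (past : List (Episode S A H)) : Policy S A H :=
  fun h x => (jointPolicy I past h x).map Prod.fst

/-- The policy of the second player in the episode after `past`: the second marginal of `σ_h`. -/
def minPolicy (I : AlgInput S A E H) (past : List (Episode S A H)) : Policy S A H :=
  fun h x => (jointPolicy I past h x).map Prod.snd

/-- The law of the list of the first `t` episodes when the algorithm with input `I` plays in an
environment with transition probabilities `P`, every episode starting at `x₁`. -/
def runLaw (I : AlgInput S A E H) (P : Fin H → S × A × A → PMF S) (x₁ : S) :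
    ℕ → PMF (List (Episode S A H))
  | 0 => PMF.pure []
  | t + 1 => (runLaw I P x₁ t).bind fun past =>
      (trajectoryLaw (jointPolicy I past) P x₁).map fun e => e :: past

/-- The episodes that precede episode `t` (counted from zero) in the complete run `run`. -/
def before (run : List (Episode S A H)) (t : ℕ) : List (Episode S A H) :=
  run.drop (run.length - t)

/-- The estimated gap, upper minus lower value of the initial state, of episode `t`. -/
def estimatedGap (I : AlgInput S A E H) (x₁ : S) (run : List (Episode S A H)) (t : ℕ) : ℝ :=
  upperV I (before run t) 0 x₁ - lowerV I (before run t) 0 x₁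

/-- The event that the policy pair of every episode `t₀` among the `T` episodes of the run that
minimizes the estimated gap is an `ε`-approximate Nash equilibrium. -/
def successEvent (I : AlgInput S A E H) (G : MarkovGame S A H) (x₁ : S) (T : ℕ) (ε : ℝ) :
    Set (List (Episode S A H)) :=
  {run | ∀ t₀ < T, (∀ t < T, estimatedGap I x₁ run t₀ ≤ estimatedGap I x₁ run t) →
    IsApproxNash G ε (maxPolicy I (before run t₀)) (minPolicy I (before run t₀)) x₁}

/-- The squared lower bound on `β / H`:
`2 Γ_K(T, lam) + 2 + 4 log (H / δ) + 2 lam (B / H)²`. -/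
def bonusLevel (φ : S × A × A → S → E) (H T : ℕ) (lam B δ : ℝ) : ℝ :=
  2 * effDim φ H T lam + 2 + 4 * Real.log (H / δ) + 2 * lam * (B / H) ^ 2

end Kernel

end KernelGame

end

/-! The duality gap of the marginal policies of an episode is bounded by the estimated gap `upperV -
lowerV`. The average estimated gap over the run is small, so its minimum is small as well.

Confidence. In a kernel mixture game the mean of `V` at the next state is linear in the unknown
parameter (`inner_phiV_eq_expect`), so regressing `V` at the next state on `phiV` is well specified
with bounded noise. Mixing Hoeffding bounds over a Gaussian (`lexpect_mixture_le`) and updating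
ridge regression by Sherman–Morrison (`ridgeError_cons`) make `mixtureRatio` a nonnegative
supermartingale. Ville's inequality `runLaw_maximal` then keeps the true parameter in all confidence
regions at all times. Its price is half the log of a determinant, which is at most the effective
dimension because `leverageProd` is a regularized Gram determinant (`det_regGram_get`).

Optimism. On this event the confidence bounds and the equilibrium inequalities give, by backward
induction, that `upperV` dominates every response to the second marginal and `lowerV` is below every
response to the first (`policyValue_le_upperV`, `lowerV_le_policyValue`).

Regret. The estimated gap is at most the expected bonus of the next episode
(`gap_le_expect_episodeBonus`). Conditional means of bonuses are controlled by the bonuses collected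
(`toOuterMeasure_meanBonus_le`), and these sum to at most `8 β H √(T Γ)` by the elliptical potential
lemma (`runSum_episodeBonus_le`).

Arithmetic. The remaining term `4 H² log (4 / δ)` has to be absorbed too, which needs a lower bound
on `Γ`. The constant function `H` has mean `H`, so its feature has norm at least `H / B`, and `T`
copies of it bound `Γ` from below (`exists_effDim_lower_bound`). When this bound is too weak, `ε ≥ 2
H` and there is nothing to prove (`accuracy_trivial_or_le`). -/

noncomputable section

namespace KernelGame

/-! ### Calculus of discrete expectations -/

open scoped ENNReal NNReal

/-- The expectation of a nonnegative extended real function under a discrete distribution. -/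
def lexpect {α : Type*} (p : PMF α) (f : α → ℝ≥0∞) : ℝ≥0∞ := ∑' a, p a * f a

section Expect

variable {α β : Type*} {p : PMF α} {f g : α → ℝ} {c : ℝ}

lemma lexpect_mono (p : PMF α) {f g : α → ℝ≥0∞} (h : ∀ a, f a ≤ g a) :
    lexpect p f ≤ lexpect p g :=
  ENNReal.tsum_le_tsum fun a => mul_le_mul_right (h a) _

lemma lexpect_const (p : PMF α) (c : ℝ≥0∞) : lexpect p (fun _ => c) = c := by
  simp [lexpect, ENNReal.tsum_mul_right]

lemma lexpect_mul_left (p : PMF α) (c : ℝ≥0∞) (f : α → ℝ≥0∞) :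
    lexpect p (fun a => c * f a) = c * lexpect p f := by
  simp only [lexpect, ← ENNReal.tsum_mul_left]
  exact tsum_congr fun a => by ring

lemma lexpect_pure (a : α) (f : α → ℝ≥0∞) : lexpect (PMF.pure a) f = f a := by
  rw [lexpect, tsum_eq_single a]
  · simp
  · intro b hb; simp [PMF.pure_apply, hb]

lemma lexpect_bind (p : PMF α) (q : α → PMF β) (f : β → ℝ≥0∞) :
    lexpect (p.bind q) f = lexpect p fun a => lexpect (q a) f := by
  simp only [lexpect, PMF.bind_apply, ← ENNReal.tsum_mul_right, ← ENNReal.tsum_mul_left]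
  rw [ENNReal.tsum_comm]
  exact tsum_congr fun a => tsum_congr fun b => by ring

lemma lexpect_map (p : PMF α) (g : α → β) (f : β → ℝ≥0∞) :
    lexpect (p.map g) f = lexpect p fun a => f (g a) := by
  simp [PMF.map, lexpect_bind, lexpect_pure]

/-- Markov's inequality. -/
lemma toOuterMeasure_le_lexpect (p : PMF α) {s : Set α} {f : α → ℝ≥0∞} {c : ℝ≥0∞}
    (h : ∀ a ∈ s, c ≤ f a) : c * p.toOuterMeasure s ≤ lexpect p f := by
  classical
  rw [PMF.toOuterMeasure_apply, ← ENNReal.tsum_mul_left]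
  refine ENNReal.tsum_le_tsum fun a => ?_
  by_cases ha : a ∈ s
  · simp only [Set.indicator_of_mem ha]
    rw [mul_comm]
    exact mul_le_mul_right (h a ha) _
  · simp [Set.indicator_of_notMem ha]

lemma summable_toReal (p : PMF α) : Summable fun a => (p a).toReal :=
  ENNReal.summable_toReal p.tsum_coe_ne_top

lemma tsum_toReal (p : PMF α) : ∑' a, (p a).toReal = 1 := by
  rw [← ENNReal.tsum_toReal_eq (fun a => p.apply_ne_top a), p.tsum_coe, ENNReal.toReal_one]

lemma summable_expect (p : PMF α) (hf : ∀ a, |f a| ≤ c) :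
    Summable fun a => (p a).toReal * f a := by
  refine Summable.of_norm_bounded ((summable_toReal p).mul_right c) fun a => ?_
  rw [Real.norm_eq_abs, abs_mul, abs_of_nonneg ENNReal.toReal_nonneg]
  exact mul_le_mul_of_nonneg_left (hf a) ENNReal.toReal_nonneg

lemma expect_const (p : PMF α) (c : ℝ) : expect p (fun _ => c) = c := by
  simp [expect, tsum_mul_right, tsum_toReal]

lemma expect_add {d : ℝ} (hf : ∀ a, |f a| ≤ c) (hg : ∀ a, |g a| ≤ d) :
    expect p (fun a => f a + g a) = expect p f + expect p g := by
  simp only [expect, mul_add]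
  exact (summable_expect p hf).tsum_add (summable_expect p hg)

lemma expect_neg (p : PMF α) (f : α → ℝ) : expect p (fun a => -f a) = -expect p f := by
  simp [expect, tsum_neg]

lemma expect_mul_left (p : PMF α) (r : ℝ) (f : α → ℝ) :
    expect p (fun a => r * f a) = r * expect p f := by
  simp only [expect, ← tsum_mul_left]
  exact tsum_congr fun a => by ring

lemma expect_sub {d : ℝ} (hf : ∀ a, |f a| ≤ c) (hg : ∀ a, |g a| ≤ d) :
    expect p (fun a => f a - g a) = expect p f - expect p g := by
  simp only [expect, mul_sub]
  exact (summable_expect p hf).tsum_sub (summable_expect p hg)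

lemma expect_mono {d : ℝ} (hf : ∀ a, |f a| ≤ c) (hg : ∀ a, |g a| ≤ d) (h : ∀ a, f a ≤ g a) :
    expect p f ≤ expect p g :=
  (summable_expect p hf).tsum_le_tsum
    (fun a => mul_le_mul_of_nonneg_left (h a) ENNReal.toReal_nonneg) (summable_expect p hg)

lemma expect_le (hf : ∀ a, |f a| ≤ c) {d : ℝ} (h : ∀ a, f a ≤ d) : expect p f ≤ d := by
  have := expect_mono (p := p) hf (fun _ => le_refl |d|) h
  rwa [expect_const] at this

lemma le_expect (hf : ∀ a, |f a| ≤ c) {d : ℝ} (h : ∀ a, d ≤ f a) : d ≤ expect p f := by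
  have := expect_mono (p := p) (fun _ => le_refl |d|) hf h
  rwa [expect_const] at this

lemma abs_expect_le (hf : ∀ a, |f a| ≤ c) : |expect p f| ≤ c :=
  abs_le.2 ⟨le_expect hf fun a => (abs_le.1 (hf a)).1, expect_le hf fun a => (abs_le.1 (hf a)).2⟩

lemma lexpect_ofReal (hf : ∀ a, |f a| ≤ c) (h0 : ∀ a, 0 ≤ f a) :
    lexpect p (fun a => ENNReal.ofReal (f a)) = ENNReal.ofReal (expect p f) := by
  rw [expect, ENNReal.ofReal_tsum_of_nonneg
    (fun a => mul_nonneg ENNReal.toReal_nonneg (h0 a)) (summable_expect p hf)]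
  refine tsum_congr fun a => ?_
  rw [ENNReal.ofReal_mul ENNReal.toReal_nonneg, ENNReal.ofReal_toReal (p.apply_ne_top a)]

/-- Shifting a bounded function to a nonnegative one transfers the unconditional exchange of sums in
`lexpect_bind` to signed expectations. -/
lemma expect_eq_toReal_lexpect (hf : ∀ a, |f a| ≤ c) :
    expect p f = (lexpect p fun a => ENNReal.ofReal (f a + c)).toReal - c := by
  have h0 : ∀ a, 0 ≤ f a + c := fun a => by linarith [(abs_le.1 (hf a)).1]
  have hb : ∀ a, |f a + c| ≤ c + |c| := fun a => (abs_add_le _ _).trans (by linarith [hf a])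
  rw [lexpect_ofReal hb h0, ENNReal.toReal_ofReal (le_expect hb h0),
    expect_add hf (fun _ => le_refl |c|), expect_const]
  ring

lemma expect_bind {q : α → PMF β} {f : β → ℝ} (hf : ∀ b, |f b| ≤ c) :
    expect (p.bind q) f = expect p fun a => expect (q a) f := by
  have h0 : ∀ a, 0 ≤ f a + c := fun a => by linarith [(abs_le.1 (hf a)).1]
  have hb : ∀ a, |f a + c| ≤ c + |c| := fun a => (abs_add_le _ _).trans (by linarith [hf a])
  rw [expect_eq_toReal_lexpect hf, lexpect_bind, expect_eq_toReal_lexpect fun a => abs_expect_le hf]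
  congr 3
  funext a
  rw [lexpect_ofReal hb h0, expect_add hf (fun _ => le_refl |c|), expect_const]

lemma expect_pure (a : α) (f : α → ℝ) : expect (PMF.pure a) f = f a := by
  rw [expect, tsum_eq_single a]
  · simp
  · intro b hb; simp [PMF.pure_apply, hb]

lemma expect_map {g : α → β} {f : β → ℝ} (hf : ∀ b, |f b| ≤ c) :
    expect (p.map g) f = expect p fun a => f (g a) := by
  rw [PMF.map, expect_bind hf]
  simp [expect_pure]

/-- Hoeffding's lemma for a bounded function on a discrete probability space. -/
lemma expect_exp_le {R : ℝ} (hf : ∀ a, |f a| ≤ R) (s : ℝ) :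
    lexpect p (fun a => ENNReal.ofReal (Real.exp (s * (f a - expect p f)))) ≤
      ENNReal.ofReal (Real.exp (s ^ 2 * R ^ 2 / 2)) := by
  -- With the discrete σ-algebra every function is measurable, so Hoeffding's lemma for measures
  -- applies. The range has length `2 R`, hence the variance proxy `R ^ 2`.
  let _ : MeasurableSpace α := ⊤
  have hm : ∀ g : α → ℝ, Measurable g := fun g => measurable_from_top
  have hint : ∀ (g : α → ℝ) (d : ℝ), (∀ a, |g a| ≤ d) →
      ∫ a, g a ∂p.toMeasure = expect p g := by
    intro g d hg
    rw [PMF.integral_eq_tsum p g (MeasureTheory.Integrable.of_bound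
      (hm g).aestronglyMeasurable d (Filter.Eventually.of_forall hg))]
    rfl
  have hexp : ∀ a, |Real.exp (s * (f a - expect p f))| ≤ Real.exp (|s| * (2 * R)) := by
    intro a
    rw [abs_of_pos (Real.exp_pos _)]
    refine Real.exp_le_exp.2 ((le_abs_self _).trans ?_)
    rw [abs_mul]
    refine mul_le_mul_of_nonneg_left ?_ (abs_nonneg s)
    have h1 := abs_le.1 (hf a)
    have h2 := abs_le.1 (abs_expect_le (p := p) hf)
    exact abs_le.2 ⟨by linarith, by linarith⟩
  rw [lexpect_ofReal hexp fun a => (Real.exp_pos _).le]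
  refine ENNReal.ofReal_le_ofReal ?_
  have key := (ProbabilityTheory.hasSubgaussianMGF_of_mem_Icc (μ := p.toMeasure) (X := f) (a := -R)
    (b := R) (hm f).aemeasurable (Filter.Eventually.of_forall fun a => abs_le.1 (hf a))).mgf_le s
  rw [ProbabilityTheory.mgf, hint f R hf, hint _ _ hexp] at key
  refine key.trans (Real.exp_le_exp.2 (le_of_eq ?_))
  push_cast
  rw [Real.norm_eq_abs, div_pow, sq_abs]
  ring

end Expect

/-! ### A one-dimensional Gaussian mixture -/

/-- Completing the square: the integrand is the left side times the density of the Gaussian of mean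
`(u + η w) / (1 + w)` and variance `w / (1 + w)`. -/
lemma ofReal_exp_mixture {w u η : ℝ} (hw : 0 < w) :
    ENNReal.ofReal ((√(1 + w))⁻¹ * Real.exp ((2 * η * u + η ^ 2 * w - u ^ 2) / (2 * (1 + w)))) =
      ∫⁻ a, ENNReal.ofReal (Real.exp (a * η - a ^ 2 / 2)) *
        ProbabilityTheory.gaussianPDF u w.toNNReal a := by
  have h1w : 0 < 1 + w := by linarith
  have hv : (w / (1 + w)).toNNReal ≠ 0 := by
    simpa using div_pos hw h1w
  rw [← mul_one (ENNReal.ofReal _), ← ProbabilityTheory.lintegral_gaussianPDF_eq_one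
    ((u + η * w) / (1 + w)) hv, ← MeasureTheory.lintegral_const_mul _
      (ProbabilityTheory.measurable_gaussianPDF _ _)]
  congr 1
  funext a
  rw [ProbabilityTheory.gaussianPDF, ProbabilityTheory.gaussianPDF,
    ← ENNReal.ofReal_mul (by positivity), ← ENNReal.ofReal_mul (Real.exp_pos _).le]
  congr 1
  rw [ProbabilityTheory.gaussianPDFReal, ProbabilityTheory.gaussianPDFReal,
    Real.coe_toNNReal _ hw.le, Real.coe_toNNReal _ (div_pos hw h1w).le]
  have hs : √(2 * Real.pi * w) = √(1 + w) * √(2 * Real.pi * (w / (1 + w))) := by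
    rw [← Real.sqrt_mul h1w.le]
    congr 1
    field_simp
  rw [hs, mul_inv]
  have e1 : ∀ x y z t : ℝ, x * Real.exp y * (z * Real.exp t) = x * z * Real.exp (y + t) := by
    intros; rw [Real.exp_add]; ring
  have e2 : ∀ y z t : ℝ, Real.exp y * (z * Real.exp t) = z * Real.exp (y + t) := by
    intros; rw [Real.exp_add]; ring
  rw [e1, e2]
  congr 2
  field_simp
  ring

/-- The normalized exponential of a quadratic function of a bounded centered random variable,
obtained by mixing the Hoeffding bounds `exp (a η - a² / 2)` over a Gaussian `a`, has expectation at
most one. -/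
lemma lexpect_mixture_le {α : Type*} {p : PMF α} {f : α → ℝ} (hf : ∀ a, |f a| ≤ 1) {w : ℝ}
    (hw : 0 ≤ w) (u : ℝ) :
    lexpect p (fun x => ENNReal.ofReal ((√(1 + w))⁻¹ *
      Real.exp ((2 * (f x - expect p f) * u + (f x - expect p f) ^ 2 * w - u ^ 2) /
        (2 * (1 + w))))) ≤ 1 := by
  have hsub : ∀ a : ℝ, lexpect p (fun x =>
      ENNReal.ofReal (Real.exp (a * (f x - expect p f) - a ^ 2 / 2))) ≤ 1 := by
    intro a
    have h := mul_le_mul_right (expect_exp_le (p := p) hf a)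
      (ENNReal.ofReal (Real.exp (-(a ^ 2 / 2))))
    rw [← lexpect_mul_left] at h
    simp only [← ENNReal.ofReal_mul (Real.exp_pos _).le, ← Real.exp_add] at h
    refine le_trans (le_of_eq ?_) (h.trans (le_of_eq ?_))
    · congr 1; funext x; congr 2; ring
    · rw [show -(a ^ 2 / 2) + a ^ 2 * 1 ^ 2 / 2 = 0 by ring]; simp
  -- For `w = 0` the mixing law degenerates to the point `u`, and the claim is the single Hoeffding
  -- bound at `a = u`.
  rcases hw.eq_or_lt with rfl | hw
  · refine le_trans (le_of_eq ?_) (hsub u)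
    congr 1; funext x
    simp only [add_zero, Real.sqrt_one, inv_one, one_mul]
    congr 2; ring
  · simp only [ofReal_exp_mixture hw, lexpect]
    have hmeas : ∀ x : α, Measurable fun a : ℝ =>
        ENNReal.ofReal (Real.exp (a * (f x - expect p f) - a ^ 2 / 2)) *
          ProbabilityTheory.gaussianPDF u w.toNNReal a := fun x =>
      (by fun_prop : Measurable fun a : ℝ =>
        ENNReal.ofReal (Real.exp (a * (f x - expect p f) - a ^ 2 / 2))).mul
          (ProbabilityTheory.measurable_gaussianPDF _ _)
    -- Exchanging sum and integral needs a countable index, while `α` is arbitrary; the sum is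
    -- restricted to the support.
    have hcount : Countable p.support := p.support_countable
    have hsupp : ∀ g : α → ℝ≥0∞, ∑' x, p x * g x = ∑' x : p.support, p x * g x := fun g =>
      (tsum_subtype_eq_of_support_subset (f := fun x => p x * g x) fun x hx => by
        rw [PMF.mem_support_iff]; exact left_ne_zero_of_mul hx).symm
    rw [hsupp]
    simp only [← MeasureTheory.lintegral_const_mul _ (hmeas _)]
    rw [← MeasureTheory.lintegral_tsum fun x : p.support =>
      ((hmeas x).const_mul (p x)).aemeasurable]
    refine le_trans (MeasureTheory.lintegral_mono fun a => ?_)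
      (ProbabilityTheory.lintegral_gaussianPDF_eq_one u (v := w.toNNReal) (by simpa using hw)).le
    simp only [← mul_assoc, ENNReal.tsum_mul_right]
    rw [← hsupp fun x => ENNReal.ofReal (Real.exp (a * (f x - expect p f) - a ^ 2 / 2))]
    exact mul_le_of_le_one_left' (hsub a)

/-! ### Ridge regression in a Hilbert space -/

section Ridge

variable {E : Type*} [NormedAddCommGroup E] [InnerProductSpace ℝ E] {lam : ℝ}

/-- The regularized covariance operator `lam • 1 + ∑ x xᵀ` of a list of vectors. -/
def covOp (lam : ℝ) : List E → E → E
  | [], y => lam • y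
  | x :: D, y => covOp lam D y + ⟪x, y⟫_ℝ • x

/-- The inverse of `covOp`, by the Sherman–Morrison formula. -/
def precOp (lam : ℝ) : List E → E → E
  | [], y => lam⁻¹ • y
  | x :: D, y => precOp lam D y -
      (⟪precOp lam D x, y⟫_ℝ / (1 + ⟪x, precOp lam D x⟫_ℝ)) • precOp lam D x

/-- The squared norm of `x` with respect to `precOp lam D`. -/
def leverage (lam : ℝ) (D : List E) (x : E) : ℝ := ⟪x, precOp lam D x⟫_ℝ

/-- The determinant of `covOp lam D / lam`, as a product of leverages. -/
def leverageProd (lam : ℝ) : List E → ℝ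
  | [] => 1
  | x :: D => leverageProd lam D * (1 + leverage lam D x)

lemma covOp_add (D : List E) (y z : E) : covOp lam D (y + z) = covOp lam D y + covOp lam D z := by
  induction D with
  | nil => simp [covOp]
  | cons x D ih => simp only [covOp, ih, inner_add_right, add_smul]; abel

lemma covOp_smul (D : List E) (c : ℝ) (y : E) : covOp lam D (c • y) = c • covOp lam D y := by
  induction D with
  | nil => simp [covOp, smul_comm c lam]
  | cons x D ih => simp only [covOp, ih, inner_smul_right, smul_add, smul_smul]

lemma covOp_sub (D : List E) (y z : E) : covOp lam D (y - z) = covOp lam D y - covOp lam D z := by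
  rw [sub_eq_add_neg, covOp_add, ← neg_one_smul ℝ z, covOp_smul, neg_one_smul, sub_eq_add_neg]

lemma precOp_add (D : List E) (y z : E) :
    precOp lam D (y + z) = precOp lam D y + precOp lam D z := by
  induction D with
  | nil => simp [precOp]
  | cons x D ih => simp only [precOp, ih, inner_add_right, add_div, add_smul]; abel

lemma precOp_smul (D : List E) (c : ℝ) (y : E) : precOp lam D (c • y) = c • precOp lam D y := by
  induction D with
  | nil => simp [precOp, smul_comm c]
  | cons x D ih =>
    simp only [precOp, ih, inner_smul_right, smul_sub, smul_smul, mul_div_assoc]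

lemma covOp_symm (D : List E) (y z : E) : ⟪covOp lam D y, z⟫_ℝ = ⟪y, covOp lam D z⟫_ℝ := by
  induction D with
  | nil => simp [covOp, inner_smul_left, inner_smul_right]
  | cons x D ih =>
    simp only [covOp, inner_add_left, inner_add_right, ih, inner_smul_left, inner_smul_right]
    rw [real_inner_comm x y]; simp; ring

lemma precOp_symm (D : List E) (y z : E) : ⟪precOp lam D y, z⟫_ℝ = ⟪y, precOp lam D z⟫_ℝ := by
  induction D with
  | nil => simp [precOp, inner_smul_left, inner_smul_right]
  | cons x D ih =>
    simp only [precOp, inner_sub_left, inner_sub_right, ih, inner_smul_left, inner_smul_right]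
    rw [real_inner_comm (precOp lam D x) y, ← ih]; simp; ring

lemma inner_covOp_self (D : List E) (y : E) :
    ⟪y, covOp lam D y⟫_ℝ = lam * ‖y‖ ^ 2 + (D.map fun x => ⟪x, y⟫_ℝ ^ 2).sum := by
  induction D with
  | nil => simp [covOp, inner_smul_right]
  | cons x D ih =>
    simp only [covOp, inner_add_right, ih, inner_smul_right, List.map_cons, List.sum_cons]
    rw [real_inner_comm x y]; ring

lemma inner_covOp_self_nonneg (hlam : 0 < lam) (D : List E) (y : E) :
    0 ≤ ⟪y, covOp lam D y⟫_ℝ := by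
  rw [inner_covOp_self]
  exact add_nonneg (by positivity) (List.sum_nonneg (by simp; intros; positivity))

/-- The two claims need each other: inverting after a rank-one update requires `1 + leverage ≠ 0`,
and nonnegativity of the new leverage follows from the new inverse and the positivity of `covOp`. -/
lemma covOp_precOp_aux (hlam : 0 < lam) (D : List E) :
    (∀ y, covOp lam D (precOp lam D y) = y) ∧ ∀ y, 0 ≤ leverage lam D y := by
  induction D with
  | nil =>
    refine ⟨fun y => by simp [covOp, precOp, smul_smul, hlam.ne'], fun y => ?_⟩
    simp only [leverage, precOp, inner_smul_right, real_inner_self_eq_norm_sq]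
    positivity
  | cons x D ih =>
    have h1 : ∀ y, covOp lam (x :: D) (precOp lam (x :: D) y) = y := by
      intro y
      have hx : 0 < 1 + ⟪x, precOp lam D x⟫_ℝ := by
        have := ih.2 x; unfold leverage at this; linarith
      simp only [covOp, precOp, covOp_sub, covOp_smul, ih.1, inner_sub_right, inner_smul_right]
      rw [sub_add, sub_eq_self, ← sub_smul, precOp_symm]
      convert zero_smul ℝ x
      field_simp
      ring
    refine ⟨h1, fun y => ?_⟩
    have := inner_covOp_self_nonneg hlam (x :: D) (precOp lam (x :: D) y)
    rwa [h1, real_inner_comm] at this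

lemma covOp_precOp (hlam : 0 < lam) (D : List E) (y : E) : covOp lam D (precOp lam D y) = y :=
  (covOp_precOp_aux hlam D).1 y

lemma leverage_nonneg (hlam : 0 < lam) (D : List E) (y : E) : 0 ≤ leverage lam D y :=
  (covOp_precOp_aux hlam D).2 y

lemma leverage_zero (D : List E) : leverage lam D 0 = 0 := by simp [leverage]

lemma eq_zero_of_inner_covOp_self_nonpos (hlam : 0 < lam) {D : List E} {y : E}
    (h : ⟪y, covOp lam D y⟫_ℝ ≤ 0) : y = 0 := by
  rw [inner_covOp_self] at h
  have h2 : 0 ≤ (D.map fun x => ⟪x, y⟫_ℝ ^ 2).sum :=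
    List.sum_nonneg (by simp; intros; positivity)
  have h3 : 0 ≤ lam * ‖y‖ ^ 2 := by positivity
  have h4 : lam * ‖y‖ ^ 2 = 0 := by linarith
  exact norm_eq_zero.1 (by simpa [hlam.ne'] using h4)

lemma eq_of_covOp_eq (hlam : 0 < lam) {D : List E} {y z : E} (h : covOp lam D y = covOp lam D z) :
    y = z := by
  refine sub_eq_zero.1 (eq_zero_of_inner_covOp_self_nonpos hlam (D := D) ?_)
  rw [covOp_sub, h, sub_self, inner_zero_right]

lemma precOp_covOp (hlam : 0 < lam) (D : List E) (y : E) : precOp lam D (covOp lam D y) = y :=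
  eq_of_covOp_eq hlam (covOp_precOp hlam D _)

lemma leverageProd_one_le (hlam : 0 < lam) (D : List E) : 1 ≤ leverageProd lam D := by
  induction D with
  | nil => simp [leverageProd]
  | cons x D ih =>
    have := leverage_nonneg hlam D x
    exact one_le_mul_of_one_le_of_one_le ih (by linarith)

/-- The Cauchy–Schwarz inequality for the inner product given by `covOp lam D`. -/
lemma inner_sq_le_leverage_mul (hlam : 0 < lam) (D : List E) (x y : E) :
    ⟪x, y⟫_ℝ ^ 2 ≤ leverage lam D x * ⟪y, covOp lam D y⟫_ℝ := by
  -- This is the quadratic form of `covOp` at `y - s • precOp lam D x`; the claim is that its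
  -- discriminant in `s` is nonpositive.
  have key : ∀ s : ℝ, 0 ≤ leverage lam D x * (s * s) + (-2 * ⟪x, y⟫_ℝ) * s +
      ⟪y, covOp lam D y⟫_ℝ := by
    intro s
    have h := inner_covOp_self_nonneg hlam D (y - s • precOp lam D x)
    rw [covOp_sub, covOp_smul, covOp_precOp hlam] at h
    simp only [inner_sub_left, inner_sub_right, inner_smul_left, inner_smul_right,
      precOp_symm, precOp_covOp hlam] at h
    rw [real_inner_comm x y] at h
    simp only [leverage]
    simp only [conj_trivial] at h
    linarith
  have := discrim_le_zero key
  rw [discrim] at this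
  linarith

/-- Each Sherman–Morrison correction subtracts a nonnegative term, so leverage only decreases from
its value for no data. -/
lemma leverage_le (hlam : 0 < lam) (D : List E) (x : E) : leverage lam D x ≤ ‖x‖ ^ 2 / lam := by
  induction D with
  | nil =>
    simp only [leverage, precOp, inner_smul_right, real_inner_self_eq_norm_sq]
    rw [div_eq_inv_mul]
  | cons z D ih =>
    refine le_trans ?_ ih
    have h1 := leverage_nonneg hlam D z
    simp only [leverage, precOp, inner_sub_right, inner_smul_right] at h1 ⊢
    rw [real_inner_comm x (precOp lam D z), sub_le_self_iff, div_mul_eq_mul_div]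
    exact div_nonneg (mul_self_nonneg _) (by linarith)

/-- The vector `∑ y x` of a list of data `(x, y)`. -/
def responseVec : List (E × ℝ) → E
  | [] => 0
  | p :: D => responseVec D + p.2 • p.1

lemma ridgeLoss_eq (D : List (E × ℝ)) (θ : E) :
    ridgeLoss lam D θ = ⟪θ, covOp lam (D.map Prod.fst) θ⟫_ℝ - 2 * ⟪responseVec D, θ⟫_ℝ +
      (D.map fun p => p.2 ^ 2).sum := by
  rw [inner_covOp_self, ridgeLoss]
  induction D with
  | nil => simp [responseVec]
  | cons p D ih =>
    simp only [List.map_cons, List.sum_cons, responseVec, inner_add_left, inner_smul_left] at ih ⊢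
    simp only [conj_trivial]
    linarith

/-- Completing the square around `m` shows that the loss exceeds its value at `m` by a definite
quadratic form. So a minimizer exists, and the one selected by `Classical.epsilon` can only be `m`.
-/
lemma ridgeEstimator_eq (hlam : 0 < lam) (D : List (E × ℝ)) :
    ridgeEstimator lam D = precOp lam (D.map Prod.fst) (responseVec D) := by
  set m := precOp lam (D.map Prod.fst) (responseVec D) with hm
  have hcov : covOp lam (D.map Prod.fst) m = responseVec D := covOp_precOp hlam _ _
  have hloss : ∀ θ, ridgeLoss lam D θ = ridgeLoss lam D m +
      ⟪θ - m, covOp lam (D.map Prod.fst) (θ - m)⟫_ℝ := by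
    intro θ
    rw [ridgeLoss_eq, ridgeLoss_eq, covOp_sub, hcov]
    simp only [inner_sub_left, inner_sub_right]
    rw [← covOp_symm _ m θ, hcov, real_inner_comm θ, real_inner_comm m]
    ring
  have hex : ∃ θ, ∀ θ', ridgeLoss lam D θ ≤ ridgeLoss lam D θ' :=
    ⟨m, fun θ' => by
      rw [hloss θ']
      linarith [inner_covOp_self_nonneg hlam (D.map Prod.fst) (θ' - m)]⟩
  have hspec : ∀ θ', ridgeLoss lam D (ridgeEstimator lam D) ≤ ridgeLoss lam D θ' :=
    Classical.epsilon_spec hex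
  have h1 := hspec m
  rw [hloss (ridgeEstimator lam D)] at h1
  exact sub_eq_zero.1 (eq_zero_of_inner_covOp_self_nonpos hlam (D := D.map Prod.fst) (by linarith))

lemma mem_confidenceSet_iff {β : ℝ} (hβ : 0 ≤ β) (D : List (E × ℝ)) (θ : E) :
    θ ∈ confidenceSet lam β D ↔
      ⟪θ - ridgeEstimator lam D, covOp lam (D.map Prod.fst) (θ - ridgeEstimator lam D)⟫_ℝ
        ≤ β ^ 2 := by
  rw [confidenceSet, Set.mem_ofPred_eq, Real.sqrt_le_left hβ, inner_covOp_self, List.map_map]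
  rfl

lemma abs_inner_sub_le {β : ℝ} (hlam : 0 < lam) (hβ : 0 ≤ β) {D : List (E × ℝ)} {θ : E}
    (hθ : θ ∈ confidenceSet lam β D) (x : E) :
    |⟪x, θ⟫_ℝ - ⟪x, ridgeEstimator lam D⟫_ℝ| ≤ β * √(leverage lam (D.map Prod.fst) x) := by
  rw [mem_confidenceSet_iff hβ] at hθ
  have hl := leverage_nonneg hlam (D.map Prod.fst) x
  rw [← inner_sub_right]
  refine abs_le_of_sq_le_sq ?_ (by positivity)
  rw [mul_pow, Real.sq_sqrt hl, mul_comm]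
  exact (inner_sq_le_leverage_mul hlam _ x _).trans (mul_le_mul_of_nonneg_left hθ hl)

lemma bddAbove_inner_confidenceSet {β : ℝ} (hlam : 0 < lam) (hβ : 0 ≤ β) (D : List (E × ℝ))
    (x : E) : BddAbove ((fun θ => ⟪x, θ⟫_ℝ) '' confidenceSet lam β D) := by
  refine ⟨⟪x, ridgeEstimator lam D⟫_ℝ + β * √(leverage lam (D.map Prod.fst) x), ?_⟩
  rintro _ ⟨θ, hθ, rfl⟩
  have := (abs_le.1 (abs_inner_sub_le hlam hβ hθ x)).2
  simp only; linarith

lemma bddBelow_inner_confidenceSet {β : ℝ} (hlam : 0 < lam) (hβ : 0 ≤ β) (D : List (E × ℝ))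
    (x : E) : BddBelow ((fun θ => ⟪x, θ⟫_ℝ) '' confidenceSet lam β D) := by
  refine ⟨⟪x, ridgeEstimator lam D⟫_ℝ - β * √(leverage lam (D.map Prod.fst) x), ?_⟩
  rintro _ ⟨θ, hθ, rfl⟩
  have := (abs_le.1 (abs_inner_sub_le hlam hβ hθ x)).1
  simp only; linarith

/-- The factor 2 is the distance between two points of the region, measured through its center. -/
lemma sSup_inner_confidenceSet_le {β : ℝ} (hlam : 0 < lam) (hβ : 0 ≤ β) {D : List (E × ℝ)} {θ : E}
    (hθ : θ ∈ confidenceSet lam β D) (x : E) :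
    sSup ((fun θ => ⟪x, θ⟫_ℝ) '' confidenceSet lam β D) ≤
      ⟪x, θ⟫_ℝ + 2 * β * √(leverage lam (D.map Prod.fst) x) := by
  refine csSup_le (Set.Nonempty.image _ ⟨θ, hθ⟩) ?_
  rintro _ ⟨θ', hθ', rfl⟩
  have h1 := (abs_le.1 (abs_inner_sub_le hlam hβ hθ x)).1
  have h2 := (abs_le.1 (abs_inner_sub_le hlam hβ hθ' x)).2
  simp only; linarith

lemma le_sInf_inner_confidenceSet {β : ℝ} (hlam : 0 < lam) (hβ : 0 ≤ β) {D : List (E × ℝ)} {θ : E}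
    (hθ : θ ∈ confidenceSet lam β D) (x : E) :
    ⟪x, θ⟫_ℝ - 2 * β * √(leverage lam (D.map Prod.fst) x) ≤
      sInf ((fun θ => ⟪x, θ⟫_ℝ) '' confidenceSet lam β D) := by
  refine le_csInf (Set.Nonempty.image _ ⟨θ, hθ⟩) ?_
  rintro _ ⟨θ', hθ', rfl⟩
  have h1 := (abs_le.1 (abs_inner_sub_le hlam hβ hθ x)).2
  have h2 := (abs_le.1 (abs_inner_sub_le hlam hβ hθ' x)).1
  simp only; linarith

/-- The vector `∑ (y - ⟪x, θ⟫) x - lam θ` of a list of data `(x, y)`. -/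
def residualVec (lam : ℝ) (θ : E) : List (E × ℝ) → E
  | [] => -(lam • θ)
  | p :: D => residualVec lam θ D + (p.2 - ⟪p.1, θ⟫_ℝ) • p.1

/-- The squared error of the ridge estimator, in the norm given by `covOp`. -/
def ridgeError (lam : ℝ) (θ : E) (D : List (E × ℝ)) : ℝ :=
  leverage lam (D.map Prod.fst) (residualVec lam θ D)

lemma residualVec_eq (θ : E) (D : List (E × ℝ)) :
    residualVec lam θ D = responseVec D - covOp lam (D.map Prod.fst) θ := by
  induction D with
  | nil => simp [residualVec, responseVec, covOp]
  | cons p D ih => simp only [residualVec, responseVec, List.map_cons, covOp, ih, sub_smul]; abel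

/-- `covOp` maps the estimation error to minus the residual vector. The residual form is the one
that can be updated one datum at a time. -/
lemma mem_confidenceSet_iff_ridgeError {β : ℝ} (hlam : 0 < lam) (hβ : 0 ≤ β) (D : List (E × ℝ))
    (θ : E) : θ ∈ confidenceSet lam β D ↔ ridgeError lam θ D ≤ β ^ 2 := by
  have h1 : covOp lam (D.map Prod.fst) (θ - ridgeEstimator lam D) = -residualVec lam θ D := by
    rw [covOp_sub, ridgeEstimator_eq hlam, covOp_precOp hlam, residualVec_eq]; abel
  have h2 : θ - ridgeEstimator lam D = precOp lam (D.map Prod.fst) (-residualVec lam θ D) := by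
    rw [← h1, precOp_covOp hlam]
  rw [mem_confidenceSet_iff hβ, h1, h2, ridgeError, leverage, ← neg_one_smul ℝ, precOp_smul,
    inner_smul_left, inner_smul_right, real_inner_comm]
  simp

lemma ridgeError_nil (hlam : 0 < lam) (θ : E) : ridgeError lam θ [] = lam * ‖θ‖ ^ 2 := by
  simp only [ridgeError, residualVec, leverage, List.map_nil, precOp, inner_smul_right,
    inner_neg_neg, smul_neg, inner_smul_left, real_inner_self_eq_norm_sq, conj_trivial]
  field_simp

/-- The increment has the shape of the exponent in `lexpect_mixture_le`: the noise is `y - ⟪x, θ⟫`,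
`w` is the leverage of `x`, and `u` depends on `x` and the earlier data only. -/
lemma ridgeError_cons (hlam : 0 < lam) (θ : E) (x : E) (y : ℝ) (D : List (E × ℝ)) :
    ridgeError lam θ ((x, y) :: D) = ridgeError lam θ D +
      (2 * (y - ⟪x, θ⟫_ℝ) * ⟪x, precOp lam (D.map Prod.fst) (residualVec lam θ D)⟫_ℝ +
        (y - ⟪x, θ⟫_ℝ) ^ 2 * leverage lam (D.map Prod.fst) x -
        ⟪x, precOp lam (D.map Prod.fst) (residualVec lam θ D)⟫_ℝ ^ 2) /
        (1 + leverage lam (D.map Prod.fst) x) := by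
  have hx := leverage_nonneg hlam (D.map Prod.fst) x
  set F := D.map Prod.fst
  set S := residualVec lam θ D
  set η := y - ⟪x, θ⟫_ℝ
  have hsx : ⟪S, precOp lam F x⟫_ℝ = ⟪x, precOp lam F S⟫_ℝ := by
    rw [← precOp_symm, real_inner_comm]
  have hd : ⟪precOp lam F x, S + η • x⟫_ℝ = ⟪x, precOp lam F S⟫_ℝ + η * leverage lam F x := by
    rw [precOp_symm, precOp_add, precOp_smul, inner_add_right, inner_smul_right]; rfl
  have e : ridgeError lam θ ((x, y) :: D) = ⟪S + η • x, precOp lam (x :: F) (S + η • x)⟫_ℝ := rfl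
  rw [e]
  simp only [precOp]
  rw [inner_sub_right, inner_smul_right, real_inner_comm (precOp lam F x) (S + η • x), hd,
    precOp_add, precOp_smul]
  simp only [inner_add_left, inner_add_right, inner_smul_left, inner_smul_right, hsx, conj_trivial]
  change _ = ⟪S, precOp lam F S⟫_ℝ + _
  change _ + η * (_ + η * leverage lam F x) - _ / (1 + leverage lam F x) * _ = _
  field_simp
  ring

end Ridge

/-! ### The regularized Gram determinant -/

section Gram

variable {E : Type*} [NormedAddCommGroup E] [InnerProductSpace ℝ E] {lam : ℝ}

/-- The matrix `I + K / lam`, with `K` the Gram matrix of `v`. -/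
def regGram {ι : Type*} [DecidableEq ι] (lam : ℝ) (v : ι → E) : Matrix ι ι ℝ :=
  1 + lam⁻¹ • Matrix.of fun i j => ⟪v i, v j⟫_ℝ

lemma sum_get_eq {α β : Type*} [AddCommMonoid β] (D : List α) (f : α → β) :
    ∑ i : Fin D.length, f (D.get i) = (D.map f).sum := by
  rw [← List.sum_ofFn]
  congr 1
  exact List.ext_get (by simp) (by simp)

lemma covOp_eq_sum (D : List E) (y : E) :
    covOp lam D y = lam • y + ∑ i : Fin D.length, ⟪D.get i, y⟫_ℝ • D.get i := by
  rw [sum_get_eq D fun x => ⟪x, y⟫_ℝ • x]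
  induction D with
  | nil => simp [covOp]
  | cons x D ih => simp only [covOp, ih, List.map_cons, List.sum_cons]; abel

/-- The quantity `1 + leverage` is the Schur complement of the regularized Gram matrix. -/
lemma one_add_leverage_eq (hlam : 0 < lam) (D : List E) (x : E)
    (hdet : IsUnit (regGram lam D.get).det) :
    1 + leverage lam D x = 1 + lam⁻¹ * ⟪x, x⟫_ℝ -
      (fun i => lam⁻¹ * ⟪x, D.get i⟫_ℝ) ⬝ᵥ
        ((regGram lam D.get)⁻¹.mulVec fun i => lam⁻¹ * ⟪D.get i, x⟫_ℝ) := by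
  set k : Fin D.length → ℝ := fun i => lam⁻¹ * ⟪D.get i, x⟫_ℝ with hk
  set c := (regGram lam D.get)⁻¹.mulVec k with hc
  have hAc : (regGram lam D.get).mulVec c = k := by
    rw [hc, Matrix.mulVec_mulVec, Matrix.mul_nonsing_inv _ hdet, Matrix.one_mulVec]
  have hAci : ∀ i, c i + lam⁻¹ * ∑ j, ⟪D.get i, D.get j⟫_ℝ * c j = lam⁻¹ * ⟪D.get i, x⟫_ℝ := by
    intro i
    have h := congrFun hAc i
    rw [regGram, Matrix.add_mulVec, Matrix.one_mulVec, Matrix.smul_mulVec] at h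
    simpa [Matrix.mulVec, dotProduct, hk] using h
  -- The kernel form of the inverse: a correction in the span of the data, with coefficients solving
  -- the Gram system. It is verified by applying `covOp`.
  have hP : precOp lam D x = lam⁻¹ • (x - ∑ i, c i • D.get i) := by
    apply eq_of_covOp_eq hlam (D := D)
    rw [covOp_precOp hlam, covOp_eq_sum, smul_smul, mul_inv_cancel₀ hlam.ne', one_smul,
      sub_add, eq_comm, sub_eq_self, ← Finset.sum_sub_distrib]
    refine Finset.sum_eq_zero fun i _ => ?_
    rw [← sub_smul, inner_smul_right, inner_sub_right, inner_sum]
    convert zero_smul ℝ _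
    have h := hAci i
    simp only [inner_smul_right]
    have e : ∑ j, c j * ⟪D.get i, D.get j⟫_ℝ = ∑ j, ⟪D.get i, D.get j⟫_ℝ * c j :=
      Finset.sum_congr rfl fun j _ => mul_comm _ _
    rw [e]
    linarith
  rw [leverage, hP, inner_smul_right, inner_sub_right, inner_sum, mul_sub, add_sub_assoc,
    Finset.mul_sum]
  simp only [inner_smul_right, dotProduct]
  congr 2
  exact Finset.sum_congr rfl fun i _ => by ring

/-- Adding a vector multiplies the determinant by its Schur complement, which is `1 + leverage`.
This links the data-driven product to the determinant in `effDim`. -/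
lemma det_regGram_get (hlam : 0 < lam) (D : List E) :
    (regGram lam D.get).det = leverageProd lam D := by
  induction D with
  | nil => simp [leverageProd, regGram]
  | cons x D ih =>
    have hdet : IsUnit (regGram lam D.get).det := by
      rw [ih]; exact (by linarith [leverageProd_one_le hlam D] : leverageProd lam D ≠ 0).isUnit
    -- The head of the list, index `0`, becomes the second block.
    let e : Fin D.length ⊕ Unit ≃ Fin (D.length + 1) :=
      (Equiv.optionEquivSumPUnit _).symm.trans (finSuccEquiv _).symm
    have hblock : (regGram lam (x :: D).get).submatrix e e =
        Matrix.fromBlocks (regGram lam D.get)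
          (Matrix.of fun i (_ : Unit) => lam⁻¹ * ⟪D.get i, x⟫_ℝ)
          (Matrix.of fun (_ : Unit) i => lam⁻¹ * ⟪x, D.get i⟫_ℝ)
          (Matrix.of fun (_ _ : Unit) => 1 + lam⁻¹ * ⟪x, x⟫_ℝ) := by
      ext i j
      rcases i with i | i <;> rcases j with j | j <;>
        simp [e, regGram, Matrix.one_apply, (Fin.succ_ne_zero _).symm]
    have : Invertible (regGram lam D.get) :=
      Matrix.invertibleOfIsUnitDet _ hdet
    have hdet' := Matrix.det_submatrix_equiv_self e (regGram lam (x :: D).get)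
    rw [hblock, Matrix.det_fromBlocks₁₁, ih, Matrix.det_unique] at hdet'
    refine hdet'.symm.trans ?_
    rw [leverageProd, one_add_leverage_eq hlam D x hdet, Matrix.invOf_eq_nonsing_inv,
      Matrix.mul_assoc]
    rfl

lemma det_regGram (hlam : 0 < lam) {n : ℕ} (v : Fin n → E) :
    (regGram lam v).det = leverageProd lam (List.ofFn v) := by
  rw [← det_regGram_get hlam, ← Matrix.det_submatrix_equiv_self
    (finCongr (List.length_ofFn (f := v)).symm)]
  congr 1
  ext i j
  simp [regGram, Matrix.one_apply, Fin.ext_iff]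

/-- Used to pad a shorter data list to exactly `T` features, as `effDim` requires. -/
lemma leverageProd_replicate_zero_append (n : ℕ) (D : List E) :
    leverageProd lam (List.replicate n 0 ++ D) = leverageProd lam D := by
  induction n with
  | zero => simp
  | succ n ih => simp [List.replicate_succ, leverageProd, leverage_zero, ih]

lemma leverageProd_le_pow (hlam : 0 < lam) {c : ℝ} {D : List E} (h : ∀ x ∈ D, ‖x‖ ≤ c) :
    leverageProd lam D ≤ (1 + c ^ 2 / lam) ^ D.length := by
  induction D with
  | nil => simp [leverageProd]
  | cons x D ih =>
    rw [leverageProd, List.length_cons, pow_succ]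
    have hx : leverage lam D x ≤ c ^ 2 / lam := (leverage_le hlam D x).trans (by
      have := h x (by simp)
      gcongr)
    have h0 := leverage_nonneg hlam D x
    have h1 := leverageProd_one_le hlam D
    exact mul_le_mul (ih fun y hy => h y (by simp [hy])) (by linarith) (by linarith)
      (le_trans (by linarith) (ih fun y hy => h y (by simp [hy])))

/-- The Gram matrix has rank one. Repeating one feature is the test family for bounding `effDim`
from below. -/
lemma det_regGram_const (x : E) (n : ℕ) :
    (regGram lam fun _ : Fin n => x).det = 1 + n * (lam⁻¹ * ‖x‖ ^ 2) := by
  have : regGram lam (fun _ : Fin n => x) =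
      1 + Matrix.replicateCol Unit (fun _ : Fin n => lam⁻¹ * ‖x‖ ^ 2) *
        Matrix.replicateRow Unit (fun _ : Fin n => (1 : ℝ)) := by
    ext i j
    simp [regGram, Matrix.mul_apply]
  rw [this, Matrix.det_one_add_replicateCol_mul_replicateRow]
  simp [dotProduct]

end Gram

/-! ### Features and the effective dimension -/

section Feature

variable {S A E : Type*} [NormedAddCommGroup E] [InnerProductSpace ℝ E]
  {φ : S × A × A → S → E} {H T : ℕ} {lam : ℝ}

lemma phiV_zero (z : S × A × A) : phiV φ 0 z = 0 := by simp [phiV]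

lemma summable_phiV (hφ : NormalizedFeature φ) {V : S → ℝ}
    (hV : ∀ s, V s ∈ Set.Icc (-(H : ℝ)) H) (z : S × A × A) :
    Summable (fun s => V s • φ z s) ∧ ‖phiV φ V z‖ ≤ H := by
  rcases Nat.eq_zero_or_pos H with rfl | hH
  · have : V = 0 := by
      funext s; have := hV s; simp at this; simpa using this
    subst this
    simp [phiV, summable_zero]
  have hH' : (0 : ℝ) < H := by exact_mod_cast hH
  obtain ⟨h1, h2⟩ := hφ (fun s => V s / H) (fun s => by
    have := hV s
    exact ⟨by rw [le_div_iff₀ hH']; linarith [this.1], by rw [div_le_one hH']; exact this.2⟩) z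
  have e : (fun s => V s • φ z s) = fun s => (H : ℝ) • (V s / H) • φ z s := by
    funext s; rw [smul_smul, mul_div_cancel₀ _ hH'.ne']
  refine ⟨by rw [e]; exact h1.const_smul _, ?_⟩
  rw [phiV, e, h1.tsum_const_smul (H : ℝ), norm_smul, Real.norm_eq_abs, abs_of_pos hH']
  exact (mul_le_mul_of_nonneg_left h2 hH'.le).trans_eq (mul_one _)

lemma inner_phiV (hφ : NormalizedFeature φ) {V : S → ℝ}
    (hV : ∀ s, V s ∈ Set.Icc (-(H : ℝ)) H) (z : S × A × A) (θ : E) :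
    ⟪phiV φ V z, θ⟫_ℝ = ∑' s, V s * ⟪φ z s, θ⟫_ℝ := by
  rw [real_inner_comm, phiV]
  have := (innerSL ℝ θ).map_tsum (summable_phiV hφ hV z).1
  simp only [innerSL_apply_apply, inner_smul_right] at this
  rw [this]
  exact tsum_congr fun s => by rw [real_inner_comm]

/-- Summability of the features lets the inner product pass through both sums, so the kernel matrix
in `effDim` is a Gram matrix. -/
lemma weightedKernel_eq (hφ : NormalizedFeature φ) {V W : S → ℝ}
    (hV : ∀ s, V s ∈ Set.Icc (-(H : ℝ)) H) (hW : ∀ s, W s ∈ Set.Icc (-(H : ℝ)) H)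
    (z y : S × A × A) : weightedKernel φ V W z y = ⟪phiV φ V z, phiV φ W y⟫_ℝ := by
  rw [weightedKernel, inner_phiV hφ hV]
  refine tsum_congr fun s => ?_
  rw [real_inner_comm, inner_phiV hφ hW, ← tsum_mul_left]
  refine tsum_congr fun t => ?_
  rw [real_inner_comm (φ z s)]; ring

/-- The vector `x` is a feature of a function with values in `[-H, H]`. -/
def IsFeature (φ : S × A × A → S → E) (H : ℕ) (x : E) : Prop :=
  ∃ (V : S → ℝ) (z : S × A × A), (∀ s, V s ∈ Set.Icc (-(H : ℝ)) H) ∧ x = phiV φ V z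

lemma det_weightedKernel (hφ : NormalizedFeature φ) (V : Fin T → S → ℝ) (z : Fin T → S × A × A)
    (hV : ∀ i s, V i s ∈ Set.Icc (-(H : ℝ)) H) :
    Matrix.det ((1 : Matrix (Fin T) (Fin T) ℝ) +
      lam⁻¹ • Matrix.of fun p q => weightedKernel φ (V p) (V q) (z p) (z q)) =
    (regGram lam fun i => phiV φ (V i) (z i)).det := by
  rw [regGram]
  congr 3
  ext p q
  exact weightedKernel_eq hφ (hV p) (hV q) _ _

lemma log_det_le_effDim (hlam : 0 < lam) (hφ : NormalizedFeature φ) (V : Fin T → S → ℝ)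
    (z : Fin T → S × A × A) (hV : ∀ i s, V i s ∈ Set.Icc (-(H : ℝ)) H) :
    1 / 2 * Real.log (regGram lam fun i => phiV φ (V i) (z i)).det ≤ effDim φ H T lam := by
  -- The supremum is a real `sSup`, so the set must be shown bounded. The bound comes from features
  -- of norm at most `H`, hence leverages at most `H ^ 2 / lam`.
  refine le_csSup ⟨1 / 2 * Real.log ((1 + (H : ℝ) ^ 2 / lam) ^ T), ?_⟩
    ⟨V, z, hV, by rw [det_weightedKernel hφ V z hV]⟩
  rintro _ ⟨V, z, hV, rfl⟩
  rw [det_weightedKernel hφ V z hV, det_regGram hlam]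
  have h1 := leverageProd_one_le hlam (List.ofFn fun i => phiV φ (V i) (z i))
  have h2 := leverageProd_le_pow hlam (c := H) (D := List.ofFn fun i => phiV φ (V i) (z i)) (by
    intro x hx
    obtain ⟨i, rfl⟩ := List.mem_ofFn.1 hx
    exact (summable_phiV hφ (hV i) (z i)).2)
  rw [List.length_ofFn] at h2
  have := Real.log_le_log (by linarith) h2
  linarith

/-- The information gain of at most `T` features is at most the effective dimension. -/
lemma log_leverageProd_le (hlam : 0 < lam) (hφ : NormalizedFeature φ) {D : List E}
    (hD : ∀ x ∈ D, IsFeature φ H x) (hT : D.length ≤ T) (z₀ : S × A × A) :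
    Real.log (leverageProd lam D) ≤ 2 * effDim φ H T lam := by
  set D' := List.replicate (T - D.length) 0 ++ D with hD'
  have hlen : D'.length = T := by simp [hD']; omega
  have hfeat : ∀ x ∈ D', IsFeature φ H x := by
    intro x hx
    rcases List.mem_append.1 hx with hx | hx
    · rw [List.eq_of_mem_replicate hx]
      exact ⟨0, z₀, fun s => by simp, (phiV_zero z₀).symm⟩
    · exact hD x hx
  rw [← leverageProd_replicate_zero_append (T - D.length), ← hD', ← det_regGram_get hlam]
  clear_value D'
  subst hlen
  have h : ∀ i : Fin D'.length, IsFeature φ H (D'.get i) := fun i => hfeat _ (D'.get_mem i)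
  choose V z hV hx using h
  have := log_det_le_effDim hlam hφ V z hV
  rw [show D'.get = fun i => phiV φ (V i) (z i) from funext hx]
  linarith

lemma log_one_add_le_effDim (hlam : 0 < lam) (hφ : NormalizedFeature φ) {x : E}
    (hx : IsFeature φ H x) :
    1 / 2 * Real.log (1 + T * (lam⁻¹ * ‖x‖ ^ 2)) ≤ effDim φ H T lam := by
  obtain ⟨V, z, hV, rfl⟩ := hx
  rw [← det_regGram_const]
  exact log_det_le_effDim hlam hφ (fun _ => V) (fun _ => z) fun _ => hV

variable {G : MarkovGame S A H} {θ : Fin H → E}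

/-- The regression model is exact: the targets of the algorithm have conditional mean linear in the
true parameter. -/
lemma inner_phiV_eq_expect (hφ : NormalizedFeature φ) (hG : IsKernelMixture G φ θ) {V : S → ℝ}
    (hV : ∀ s, V s ∈ Set.Icc (-(H : ℝ)) H) (h : Fin H) (z : S × A × A) :
    ⟪phiV φ V z, θ h⟫_ℝ = expect (G.trans h z) V := by
  rw [inner_phiV hφ hV, expect]
  exact tsum_congr fun s => by rw [hG, mul_comm]

/-- Take `V` constant equal to `H`. Its mean is `H`, so Cauchy–Schwarz gives `H ≤ ‖phiV‖ * B`. -/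
lemma exists_feature_norm (hH : 1 ≤ H) (hφ : NormalizedFeature φ) (hG : IsKernelMixture G φ θ)
    {B : ℝ} (hθ : ∀ h, ‖θ h‖ ≤ B) (z : S × A × A) :
    0 < B ∧ ∃ x, IsFeature φ H x ∧ (H : ℝ) / B ≤ ‖x‖ := by
  have hH' : (0 : ℝ) < H := by exact_mod_cast hH
  have hV : ∀ s : S, (fun _ => (H : ℝ)) s ∈ Set.Icc (-(H : ℝ)) H := fun s => ⟨by simp, le_refl _⟩
  have h := inner_phiV_eq_expect hφ hG hV ⟨0, hH⟩ z
  rw [expect_const] at h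
  have h1 : (H : ℝ) ≤ ‖phiV φ (fun _ => (H : ℝ)) z‖ * B := by
    exact h.symm.le.trans <| (real_inner_le_norm _ _).trans
      (mul_le_mul_of_nonneg_left (hθ _) (norm_nonneg _))
  have hB : 0 < B := by
    by_contra hB
    have := mul_nonpos_of_nonneg_of_nonpos (norm_nonneg (phiV φ (fun _ => (H : ℝ)) z))
      (not_lt.1 hB)
    linarith
  exact ⟨hB, _, ⟨_, z, hV, rfl⟩, (div_le_iff₀ hB).2 h1⟩

end Feature

/-! ### Expectations over trajectories -/

section Trajectory

open scoped ENNReal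

variable {S A : Type*}

lemma abs_sum_reward_le {k : ℕ} {r : Fin k → S × A × A → ℝ} {c : ℝ} (hr : ∀ h z, |r h z| ≤ c)
    (e : Fin k → Step S A) : |∑ h, r h (e h).triple| ≤ k * c := by
  refine (Finset.abs_sum_le_sum_abs _ _).trans ((Finset.sum_le_sum fun h _ => hr h _).trans ?_)
  simp

lemma expect_trajectoryLaw_succ {k : ℕ} (σ : Fin (k + 1) → S → PMF (A × A))
    (P : Fin (k + 1) → S × A × A → PMF S) (x : S) {r : Fin (k + 1) → S × A × A → ℝ} {c : ℝ}
    (hr : ∀ h z, |r h z| ≤ c) :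
    expect (trajectoryLaw σ P x) (fun e => ∑ h, r h (e h).triple) =
      expect (σ 0 x) fun ab => r 0 (x, ab.1, ab.2) + expect (P 0 (x, ab.1, ab.2)) fun y =>
        expect (trajectoryLaw (fun i => σ i.succ) (fun i => P i.succ) y)
          fun e => ∑ h, r h.succ (e h).triple := by
  rw [trajectoryLaw, expect_bind (abs_sum_reward_le hr)]
  congr 1; funext ab
  rw [expect_bind (abs_sum_reward_le hr)]
  have h1 : ∀ y, expect ((trajectoryLaw (fun i => σ i.succ) (fun i => P i.succ) y).map
      fun e => (Fin.cons ⟨x, ab.1, ab.2, y⟩ e : Fin (k + 1) → Step S A))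
        (fun e => ∑ h, r h (e h).triple) = r 0 (x, ab.1, ab.2) +
      expect (trajectoryLaw (fun i => σ i.succ) (fun i => P i.succ) y)
          fun e => ∑ h, r h.succ (e h).triple := by
    intro y
    rw [expect_map (abs_sum_reward_le hr)]
    simp only [Fin.sum_univ_succ, Fin.cons_zero, Fin.cons_succ, Step.triple]
    have h2 := expect_add (p := trajectoryLaw (fun i => σ i.succ) (fun i => P i.succ) y)
      (fun _ => hr 0 (x, ab.1, ab.2)) (abs_sum_reward_le fun h => hr h.succ)
    rw [expect_const] at h2
    exact h2
  simp only [h1]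
  rw [expect_add (fun _ => hr 0 _) (fun y => abs_expect_le
    (abs_sum_reward_le fun h => hr h.succ)), expect_const]

/-- A function satisfying the Bellman inequality dominates the expected total reward. -/
lemma expect_trajectoryLaw_le {k : ℕ} (σ : Fin k → S → PMF (A × A))
    (P : Fin k → S × A × A → PMF S) (x : S) {r : Fin k → S × A × A → ℝ} {c d : ℝ}
    (hr : ∀ h z, |r h z| ≤ c) {U : Fin (k + 1) → S → ℝ} (hU : ∀ h x, |U h x| ≤ d)
    (hlast : ∀ x, 0 ≤ U (Fin.last k) x)
    (hstep : ∀ h x, expect (σ h x) (fun ab => r h (x, ab.1, ab.2) +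
      expect (P h (x, ab.1, ab.2)) (U h.succ)) ≤ U h.castSucc x) :
    expect (trajectoryLaw σ P x) (fun e => ∑ h, r h (e h).triple) ≤ U 0 x := by
  induction k generalizing x with
  | zero => simpa [expect_const] using hlast x
  | succ k ih =>
    rw [expect_trajectoryLaw_succ σ P x hr]
    refine le_trans ?_ (hstep 0 x)
    have hb : ∀ y, |expect (trajectoryLaw (fun i => σ i.succ) (fun i => P i.succ) y)
        fun e => ∑ h, r h.succ (e h).triple| ≤ k * c := fun y =>
      abs_expect_le (abs_sum_reward_le fun h => hr h.succ)
    refine expect_mono (c := c + k * c) (d := c + d)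
      (fun ab => (abs_add_le _ _).trans (add_le_add (hr _ _) (abs_expect_le hb)))
      (fun ab => (abs_add_le _ _).trans (add_le_add (hr _ _) (abs_expect_le (hU _)))) fun ab => ?_
    refine add_le_add_right (expect_mono hb (hU _) fun y => ?_) _
    exact ih (fun i => σ i.succ) (fun i => P i.succ) y (fun h => hr h.succ)
      (U := fun h => U h.succ) (fun h => hU h.succ) hlast fun h => hstep h.succ

lemma le_expect_trajectoryLaw {k : ℕ} (σ : Fin k → S → PMF (A × A))
    (P : Fin k → S × A × A → PMF S) (x : S) {r : Fin k → S × A × A → ℝ} {c d : ℝ}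
    (hr : ∀ h z, |r h z| ≤ c) {U : Fin (k + 1) → S → ℝ} (hU : ∀ h x, |U h x| ≤ d)
    (hlast : ∀ x, U (Fin.last k) x ≤ 0)
    (hstep : ∀ h x, U h.castSucc x ≤ expect (σ h x) (fun ab => r h (x, ab.1, ab.2) +
      expect (P h (x, ab.1, ab.2)) (U h.succ))) :
    U 0 x ≤ expect (trajectoryLaw σ P x) (fun e => ∑ h, r h (e h).triple) := by
  have h := expect_trajectoryLaw_le σ P x (r := fun h z => -r h z) (c := c) (d := d)
    (by simpa using hr) (U := fun h x => -U h x) (by simpa using hU) (by simpa using hlast)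
    (fun h x => by
      simp only [expect_neg, ← neg_add]
      exact neg_le_neg (hstep h x))
  simp only [Finset.sum_neg_distrib, expect_neg] at h
  linarith

/-- A nonnegative function of a triplet and the next state whose conditional mean given the triplet
is at most one has mean at most one along a trajectory. -/
lemma lexpect_trajectoryLaw_step_le {k : ℕ} (σ : Fin k → S → PMF (A × A))
    (P : Fin k → S × A × A → PMF S) (x : S) (h : Fin k) {f : S × A × A → S → ℝ≥0∞}
    {c : ℝ≥0∞} (hf : ∀ z, lexpect (P h z) (f z) ≤ c) :
    lexpect (trajectoryLaw σ P x) (fun e => f (e h).triple (e h).next) ≤ c := by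
  induction k generalizing x with
  | zero => exact h.elim0
  | succ k ih =>
    rw [trajectoryLaw, lexpect_bind, ← lexpect_const (σ 0 x) c]
    refine lexpect_mono _ fun ab => ?_
    rw [lexpect_bind]
    cases h using Fin.cases with
    | zero =>
      refine le_trans (le_of_eq ?_) (hf (x, ab.1, ab.2))
      congr 1; funext y
      rw [lexpect_map]
      simp [Step.triple, lexpect_const]
    | succ h =>
      rw [← lexpect_const (P 0 (x, ab.1, ab.2)) c]
      refine lexpect_mono _ fun y => ?_
      rw [lexpect_map]
      exact ih (fun i => σ i.succ) (fun i => P i.succ) y h hf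

end Trajectory

/-! ### Supermartingales along a run of the algorithm -/

section Run

open scoped ENNReal

variable {S A E : Type*} [NormedAddCommGroup E] [InnerProductSpace ℝ E] {H : ℕ}
  {I : AlgInput S A E H} {P : Fin H → S × A × A → PMF S} {x₁ : S}

lemma lexpect_runLaw_le {M : List (Episode S A H) → ℝ≥0∞} (h0 : M [] ≤ 1)
    (hM : ∀ past, lexpect (trajectoryLaw (jointPolicy I past) P x₁) (fun e => M (e :: past)) ≤
      M past) (t : ℕ) : lexpect (runLaw I P x₁ t) M ≤ 1 := by
  induction t with
  | zero => rwa [runLaw, lexpect_pure]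
  | succ t ih =>
    rw [runLaw, lexpect_bind]
    refine le_trans (lexpect_mono _ fun past => ?_) ih
    rw [lexpect_map]
    exact hM past

open Classical in
/-- The process `M` stopped when it reaches the level `c`. -/
def stopAt (c : ℝ≥0∞) (M : List (Episode S A H) → ℝ≥0∞) : List (Episode S A H) → ℝ≥0∞
  | [] => M []
  | e :: past => if c ≤ stopAt c M past then stopAt c M past else M (e :: past)

/-- The most recent episode is the head, so the earlier times of a run are its suffixes. The stopped
process never leaves the level once there. -/
lemma le_stopAt {c : ℝ≥0∞} {M : List (Episode S A H) → ℝ≥0∞} {run past : List (Episode S A H)}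
    (hs : past <:+ run) (hc : c ≤ M past) : c ≤ stopAt c M run := by
  induction run with
  | nil => rw [List.suffix_nil.1 hs] at hc; exact hc
  | cons e run ih =>
    rw [stopAt]
    split_ifs with h
    · exact h
    · rcases List.suffix_cons_iff.1 hs with rfl | hs
      · exact hc
      · exact absurd (ih hs) h

lemma stopAt_eq {c : ℝ≥0∞} {M : List (Episode S A H) → ℝ≥0∞} {past : List (Episode S A H)}
    (h : ¬ c ≤ stopAt c M past) : stopAt c M past = M past := by
  cases past with
  | nil => rfl
  | cons e past =>
    rw [stopAt] at h ⊢
    split_ifs with h'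
    · rw [if_pos h'] at h; exact absurd h' h
    · rfl

/-- Ville's maximal inequality. -/
lemma runLaw_maximal {M : List (Episode S A H) → ℝ≥0∞} (h0 : M [] ≤ 1)
    (hM : ∀ past, lexpect (trajectoryLaw (jointPolicy I past) P x₁) (fun e => M (e :: past)) ≤
      M past) (t : ℕ) (c : ℝ≥0∞) :
    c * (runLaw I P x₁ t).toOuterMeasure {run | ∃ past, past <:+ run ∧ c ≤ M past} ≤ 1 := by
  -- Markov's inequality for the stopped process: it is at least `c` at the final time if `M` ever
  -- was, and it is still a supermartingale because at each step it is frozen or moves as `M`.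
  refine (toOuterMeasure_le_lexpect _ (f := stopAt c M) ?_).trans
    (lexpect_runLaw_le (M := stopAt c M) h0 ?_ t)
  · rintro run ⟨past, hs, hc⟩
    exact le_stopAt hs hc
  · intro past
    by_cases h : c ≤ stopAt c M past
    · simp only [stopAt, if_pos h, lexpect_const, le_refl]
    · simp only [stopAt, if_neg h]
      rw [stopAt_eq h]
      exact hM past

lemma length_of_mem_support_runLaw {t : ℕ} {run : List (Episode S A H)}
    (h : run ∈ (runLaw I P x₁ t).support) : run.length = t := by
  induction t generalizing run with
  | zero => simp [runLaw] at h; simp [h]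
  | succ t ih =>
    simp only [runLaw, PMF.mem_support_bind_iff, PMF.mem_support_map_iff] at h
    obtain ⟨past, hp, e, -, rfl⟩ := h
    simp [ih hp]

end Run

/-! ### The value estimates of the algorithm -/

section Clip

variable {H : ℕ}

lemma clip_mem (H : ℕ) (x : ℝ) : clip H x ∈ Set.Icc (-(H : ℝ)) H :=
  ⟨le_max_left _ _, max_le (by linarith [H.cast_nonneg (α := ℝ)]) (min_le_left _ _)⟩

lemma abs_clip_le (H : ℕ) (x : ℝ) : |clip H x| ≤ H := abs_le.2 (clip_mem H x)

lemma clip_mono {x y : ℝ} (h : x ≤ y) : clip H x ≤ clip H y :=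
  max_le_max_left _ (min_le_min_left _ h)

lemma le_clip {x y : ℝ} (h : y ≤ H) (hxy : y ≤ x) : y ≤ clip H x :=
  (le_min h hxy).trans (le_max_right _ _)

lemma clip_le {x y : ℝ} (h : -(H : ℝ) ≤ y) (hxy : x ≤ y) : clip H x ≤ y :=
  max_le h ((min_le_right _ _).trans hxy)

lemma clip_sub_clip_le {x y d : ℝ} (hd : 0 ≤ d) (h : x - y ≤ d) : clip H x - clip H y ≤ d := by
  have h1 := (clip_mem H y).1
  have h2 : min (H : ℝ) x ≤ min (H : ℝ) y + d := by
    rcases min_cases (H : ℝ) y with ⟨e, -⟩ | ⟨e, -⟩ <;> rw [e]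
    · linarith [min_le_left (H : ℝ) x]
    · linarith [min_le_right (H : ℝ) x]
  have h3 : min (H : ℝ) y ≤ clip H y := le_max_right _ _
  have h4 : clip H x ≤ clip H y + d := max_le (by linarith) (by linarith)
  linarith

end Clip

section Values

variable {S A E : Type*} [NormedAddCommGroup E] [InnerProductSpace ℝ E] {H : ℕ}
  {I : AlgInput S A E H}

lemma upperQ_mem (I : AlgInput S A E H) (L : List (Record S A H)) (h : Fin H) (V : S → ℝ)
    (z : S × A × A) : upperQ I L h V z ∈ Set.Icc (-(H : ℝ)) H := clip_mem _ _

lemma lowerQ_mem (I : AlgInput S A E H) (L : List (Record S A H)) (h : Fin H) (V : S → ℝ)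
    (z : S × A × A) : lowerQ I L h V z ∈ Set.Icc (-(H : ℝ)) H := clip_mem _ _

lemma upperV_last (past : List (Episode S A H)) : upperV I past (Fin.last H) = 0 := by
  rw [upperV, valuePair, Fin.reverseInduction_last]

lemma lowerV_last (past : List (Episode S A H)) : lowerV I past (Fin.last H) = 0 := by
  rw [lowerV, valuePair, Fin.reverseInduction_last]

lemma upperV_castSucc (past : List (Episode S A H)) (h : Fin H) (x : S) :
    upperV I past h.castSucc x = expect (jointPolicy I past h x) fun p =>
      upperQ I (records I past) h (upperV I past h.succ) (x, p.1, p.2) := by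
  rw [upperV, valuePair, Fin.reverseInduction_castSucc]
  rfl

lemma lowerV_castSucc (past : List (Episode S A H)) (h : Fin H) (x : S) :
    lowerV I past h.castSucc x = expect (jointPolicy I past h x) fun p =>
      lowerQ I (records I past) h (lowerV I past h.succ) (x, p.1, p.2) := by
  rw [lowerV, valuePair, Fin.reverseInduction_castSucc]
  rfl

lemma upperV_mem (I : AlgInput S A E H) (past : List (Episode S A H)) (h : Fin (H + 1)) (x : S) :
    upperV I past h x ∈ Set.Icc (-(H : ℝ)) H := by
  cases h using Fin.lastCases with
  | last => rw [upperV_last]; simp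
  | cast h =>
    rw [upperV_castSucc]
    exact abs_le.1 (abs_expect_le fun _ => abs_le.2 (upperQ_mem _ _ _ _ _))

lemma lowerV_mem (I : AlgInput S A E H) (past : List (Episode S A H)) (h : Fin (H + 1)) (x : S) :
    lowerV I past h x ∈ Set.Icc (-(H : ℝ)) H := by
  cases h using Fin.lastCases with
  | last => rw [lowerV_last]; simp
  | cast h =>
    rw [lowerV_castSucc]
    exact abs_le.1 (abs_expect_le fun _ => abs_le.2 (lowerQ_mem _ _ _ _ _))

/-- The functions `V past` are the estimates that `est` reads from the record of the episode that
follows `past`, and they take their values in `[-H, H]`. -/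
structure IsEstimate (I : AlgInput S A E H) (est : Record S A H → Fin (H + 1) → S → ℝ)
    (V : List (Episode S A H) → Fin (H + 1) → S → ℝ) : Prop where
  mem : ∀ past h x, V past h x ∈ Set.Icc (-(H : ℝ)) H
  est_eq : ∀ e past, est ⟨e, upperV I past, lowerV I past⟩ = V past

lemma isEstimate_upper (I : AlgInput S A E H) : IsEstimate I Record.upper (upperV I) :=
  ⟨upperV_mem I, fun _ _ => rfl⟩

lemma isEstimate_lower (I : AlgInput S A E H) : IsEstimate I Record.lower (lowerV I) :=
  ⟨lowerV_mem I, fun _ _ => rfl⟩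

variable {est : Record S A H → Fin (H + 1) → S → ℝ}
  {V : List (Episode S A H) → Fin (H + 1) → S → ℝ}

/-- The regression data available after the episodes `past`. -/
def pastData (I : AlgInput S A E H) (est : Record S A H → Fin (H + 1) → S → ℝ) (h : Fin H)
    (past : List (Episode S A H)) : List (E × ℝ) :=
  regressionData I (records I past) est h

/-- The function `V past h.succ` is fixed before the episode is played. Hence, given the past and
the triplet, only the next state in the new datum is random. -/
lemma pastData_cons (hV : IsEstimate I est V) (h : Fin H) (e : Episode S A H)
    (past : List (Episode S A H)) :
    pastData I est h (e :: past) =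
      (phiV I.feature (V past h.succ) (e h).triple, V past h.succ (e h).next) ::
        pastData I est h past := by
  rw [← hV.est_eq e past]
  rfl

lemma length_pastData (h : Fin H) (past : List (Episode S A H)) :
    (pastData I est h past).length = past.length := by
  induction past with
  | nil => rfl
  | cons e past ih =>
    rw [pastData, regressionData, List.length_map] at ih ⊢
    simp [records, ih]

lemma isFeature_of_mem_pastData (hV : IsEstimate I est V) (h : Fin H)
    (past : List (Episode S A H)) :
    ∀ x ∈ (pastData I est h past).map Prod.fst, IsFeature I.feature H x := by
  induction past with
  | nil => simp [pastData, regressionData, records]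
  | cons e past ih =>
    rw [pastData_cons hV, List.map_cons]
    intro x hx
    rcases List.mem_cons.1 hx with rfl | hx
    · exact ⟨_, _, hV.mem past h.succ, rfl⟩
    · exact ih x hx

lemma log_leverageProd_pastData_le (hlam : 0 < I.lam) (hφ : NormalizedFeature I.feature)
    (hV : IsEstimate I est V) (h : Fin H) {past : List (Episode S A H)} {T : ℕ}
    (hT : past.length ≤ T) (z₀ : S × A × A) :
    Real.log (leverageProd I.lam ((pastData I est h past).map Prod.fst)) ≤
      2 * effDim I.feature H T I.lam :=
  log_leverageProd_le hlam hφ (isFeature_of_mem_pastData hV h past)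
    (by rwa [List.length_map, length_pastData]) z₀

end Values

/-! ### Validity of the confidence regions -/

section Confidence

open scoped ENNReal

variable {S A E : Type*} [NormedAddCommGroup E] [InnerProductSpace ℝ E] {H : ℕ}
  {I : AlgInput S A E H} {G : MarkovGame S A H} {θ : Fin H → E}
  {est : Record S A H → Fin (H + 1) → S → ℝ} {V : List (Episode S A H) → Fin (H + 1) → S → ℝ}

/-- The likelihood ratio, against the parameter `θ`, of a Gaussian mixture of models centered at
zero. -/
def mixtureRatio (lam : ℝ) (H : ℕ) (θ : E) (D : List (E × ℝ)) : ℝ :=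
  (√(leverageProd lam (D.map Prod.fst)))⁻¹ *
    Real.exp ((ridgeError lam θ D - lam * ‖θ‖ ^ 2) / (2 * H ^ 2))

lemma mixtureRatio_nonneg (lam : ℝ) (H : ℕ) (θ : E) (D : List (E × ℝ)) :
    0 ≤ mixtureRatio lam H θ D := by
  unfold mixtureRatio; positivity

lemma mixtureRatio_nil {lam : ℝ} (hlam : 0 < lam) (H : ℕ) (θ : E) :
    mixtureRatio lam H θ [] = 1 := by
  simp [mixtureRatio, leverageProd, ridgeError_nil hlam]

/-- Dividing by `H` makes the targets bounded by one, so the new factor is the integrand of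
`lexpect_mixture_le`. -/
lemma mixtureRatio_cons {lam : ℝ} (hlam : 0 < lam) (hH : 1 ≤ H) (θ x : E) (y : ℝ)
    (D : List (E × ℝ)) :
    mixtureRatio lam H θ ((x, y) :: D) = mixtureRatio lam H θ D *
      ((√(1 + leverage lam (D.map Prod.fst) x))⁻¹ * Real.exp (
        (2 * (y / H - ⟪x, θ⟫_ℝ / H) *
            (⟪x, precOp lam (D.map Prod.fst) (residualVec lam θ D)⟫_ℝ / H) +
          (y / H - ⟪x, θ⟫_ℝ / H) ^ 2 * leverage lam (D.map Prod.fst) x -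
          (⟪x, precOp lam (D.map Prod.fst) (residualVec lam θ D)⟫_ℝ / H) ^ 2) /
          (2 * (1 + leverage lam (D.map Prod.fst) x)))) := by
  have hH' : (0 : ℝ) < H := by exact_mod_cast hH
  have hx := leverage_nonneg hlam (D.map Prod.fst) x
  have hp := leverageProd_one_le hlam (D.map Prod.fst)
  rw [mixtureRatio, mixtureRatio, ridgeError_cons hlam, List.map_cons, leverageProd,
    Real.sqrt_mul (by linarith), mul_inv, mul_mul_mul_comm, ← Real.exp_add]
  congr 2
  field_simp
  ring

/-- The supermartingale property. Given the triplet the noise is centered, by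
`inner_phiV_eq_expect`, so the new factor has conditional mean at most one. -/
lemma lexpect_mixtureRatio_le (hH : 1 ≤ H) (hlam : 0 < I.lam) (hφ : NormalizedFeature I.feature)
    (hG : IsKernelMixture G I.feature θ) (hV : IsEstimate I est V) (h : Fin H) (x₁ : S)
    (past : List (Episode S A H)) :
    lexpect (trajectoryLaw (jointPolicy I past) G.trans x₁) (fun e =>
      ENNReal.ofReal (mixtureRatio I.lam H (θ h) (pastData I est h (e :: past)))) ≤
    ENNReal.ofReal (mixtureRatio I.lam H (θ h) (pastData I est h past)) := by
  have hH' : (0 : ℝ) < H := by exact_mod_cast hH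
  simp only [pastData_cons hV]
  refine lexpect_trajectoryLaw_step_le _ _ x₁ h (f := fun z y =>
    ENNReal.ofReal (mixtureRatio I.lam H (θ h)
      ((phiV I.feature (V past h.succ) z, V past h.succ y) :: pastData I est h past)))
    fun z => ?_
  simp only [mixtureRatio_cons hlam hH, ENNReal.ofReal_mul (mixtureRatio_nonneg _ _ _ _)]
  rw [lexpect_mul_left]
  refine mul_le_of_le_one_right' ?_
  have hb : ∀ y, |V past h.succ y / H| ≤ 1 := fun y => by
    rw [abs_div, abs_of_pos hH', div_le_one hH']
    exact abs_le.2 (hV.mem past h.succ y)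
  have he : expect (G.trans h z) (fun y => V past h.succ y / H) =
      ⟪phiV I.feature (V past h.succ) z, θ h⟫_ℝ / H := by
    rw [inner_phiV_eq_expect hφ hG (hV.mem past h.succ)]
    simp only [div_eq_inv_mul]
    rw [expect_mul_left]
  have key := lexpect_mixture_le (p := G.trans h z) hb
    (leverage_nonneg hlam ((pastData I est h past).map Prod.fst)
      (phiV I.feature (V past h.succ) z))
    (⟪phiV I.feature (V past h.succ) z, precOp I.lam ((pastData I est h past).map Prod.fst)
      (residualVec I.lam (θ h) (pastData I est h past))⟫_ℝ / H)
  rw [he] at key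
  exact key

/-- With high probability the confidence region of step `h` contains the true parameter throughout
the run. -/
lemma toOuterMeasure_notMem_confidenceSet_le (hH : 1 ≤ H) (hlam : 0 < I.lam) (hβ : 0 ≤ I.β)
    (hφ : NormalizedFeature I.feature) (hG : IsKernelMixture G I.feature θ) {B : ℝ}
    (hθ : ∀ h, ‖θ h‖ ≤ B) (hV : IsEstimate I est V) (h : Fin H) (x₁ : S) (z₀ : S × A × A)
    (T : ℕ) {c : ℝ} (hc : 2 * effDim I.feature H T I.lam + 2 * c + I.lam * (B / H) ^ 2 ≤
      (I.β / H) ^ 2) :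
    (runLaw I G.trans x₁ T).toOuterMeasure {run | run.length = T ∧ ∃ past, past <:+ run ∧
      θ h ∉ confidenceSet I.lam I.β (pastData I est h past)} ≤ ENNReal.ofReal (Real.exp (-c)) := by
  have hH' : (0 : ℝ) < H := by exact_mod_cast hH
  have hmax := runLaw_maximal (I := I) (P := G.trans) (x₁ := x₁)
    (M := fun past => ENNReal.ofReal (mixtureRatio I.lam H (θ h) (pastData I est h past)))
    (by simp [pastData, regressionData, records, mixtureRatio_nil hlam])
    (lexpect_mixtureRatio_le hH hlam hφ hG hV h x₁) T (ENNReal.ofReal (Real.exp c))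
  rw [Real.exp_neg, ENNReal.ofReal_inv_of_pos (Real.exp_pos _)]
  rw [ENNReal.le_inv_iff_mul_le, mul_comm]
  refine le_trans (mul_le_mul_right (MeasureTheory.measure_mono ?_) _) hmax
  rintro run ⟨hlen, past, hs, hp⟩
  refine ⟨past, hs, ENNReal.ofReal_le_ofReal ?_⟩
  rw [mem_confidenceSet_iff_ridgeError hlam hβ, not_le] at hp
  -- A suffix of a run of length `T` holds at most `T` features, so half its log determinant is at
  -- most `Γ`. Leaving the region then makes the log of `mixtureRatio` at least `((β / H)² - lam (B
  -- / H)²) / 2 - Γ ≥ c`.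
  have hdim := log_leverageProd_pastData_le hlam hφ hV h (hlen ▸ hs.length_le) z₀
  set D := pastData I est h past
  have h1 := leverageProd_one_le hlam (D.map Prod.fst)
  have h2 : (√(leverageProd I.lam (D.map Prod.fst)))⁻¹ =
      Real.exp (-(Real.log (leverageProd I.lam (D.map Prod.fst)) / 2)) := by
    rw [Real.exp_neg, ← Real.log_sqrt (by linarith),
      Real.exp_log (Real.sqrt_pos.2 (by linarith))]
  rw [mixtureRatio, h2, ← Real.exp_add]
  refine Real.exp_le_exp.2 ?_
  have h3 : ‖θ h‖ ^ 2 ≤ B ^ 2 := pow_le_pow_left₀ (norm_nonneg _) (hθ h) 2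
  have h4 : ((I.β / H) ^ 2 - I.lam * (B / H) ^ 2) / 2 ≤
      (ridgeError I.lam (θ h) D - I.lam * ‖θ h‖ ^ 2) / (2 * H ^ 2) := by
    have h5 : ((I.β / H) ^ 2 - I.lam * (B / H) ^ 2) / 2 =
        (I.β ^ 2 - I.lam * B ^ 2) / (2 * H ^ 2) := by field_simp
    rw [h5]
    have := mul_le_mul_of_nonneg_left h3 hlam.le
    gcongr
  linarith

end Confidence

/-! ### Optimism and the estimated gap -/

section Optimism

variable {S A E : Type*} [NormedAddCommGroup E] [InnerProductSpace ℝ E] {H : ℕ}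
  {I : AlgInput S A E H} {G : MarkovGame S A H} {θ : Fin H → E} {past : List (Episode S A H)}

/-- The confidence regions computed from the episodes `past` contain the parameters `θ`. -/
def AllConfident (I : AlgInput S A E H) (θ : Fin H → E) (past : List (Episode S A H)) : Prop :=
  ∀ h, θ h ∈ confidenceSet I.lam I.β (pastData I Record.upper h past) ∧
    θ h ∈ confidenceSet I.lam I.β (pastData I Record.lower h past)

/-- The squared width, in units of the confidence radius, of the confidence interval for the
expectation of `V past h.succ` at `z`. -/
def stepLeverage (I : AlgInput S A E H) (est : Record S A H → Fin (H + 1) → S → ℝ)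
    (V : List (Episode S A H) → Fin (H + 1) → S → ℝ) (past : List (Episode S A H)) (h : Fin H)
    (z : S × A × A) : ℝ :=
  leverage I.lam ((pastData I est h past).map Prod.fst) (phiV I.feature (V past h.succ) z)

lemma clip_le_upperQ (hlam : 0 < I.lam) (hβ : 0 ≤ I.β) (hφ : NormalizedFeature I.feature)
    (hG : IsKernelMixture G I.feature θ) (hgood : AllConfident I θ past) (h : Fin H)
    (z : S × A × A) :
    clip H (I.reward h z + expect (G.trans h z) (upperV I past h.succ)) ≤
      upperQ I (records I past) h (upperV I past h.succ) z := by
  rw [← inner_phiV_eq_expect hφ hG (upperV_mem I past h.succ)]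
  exact clip_mono (add_le_add_right (le_csSup (bddAbove_inner_confidenceSet hlam hβ _ _)
    ⟨_, (hgood h).1, rfl⟩) _)

lemma lowerQ_le_clip (hlam : 0 < I.lam) (hβ : 0 ≤ I.β) (hφ : NormalizedFeature I.feature)
    (hG : IsKernelMixture G I.feature θ) (hgood : AllConfident I θ past) (h : Fin H)
    (z : S × A × A) :
    lowerQ I (records I past) h (lowerV I past h.succ) z ≤
      clip H (I.reward h z + expect (G.trans h z) (lowerV I past h.succ)) := by
  rw [← inner_phiV_eq_expect hφ hG (lowerV_mem I past h.succ)]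
  exact clip_mono (add_le_add_right (csInf_le (bddBelow_inner_confidenceSet hlam hβ _ _)
    ⟨_, (hgood h).2, rfl⟩) _)

lemma upperQ_le_clip (hlam : 0 < I.lam) (hβ : 0 ≤ I.β) (hφ : NormalizedFeature I.feature)
    (hG : IsKernelMixture G I.feature θ) (hgood : AllConfident I θ past) (h : Fin H)
    (z : S × A × A) :
    upperQ I (records I past) h (upperV I past h.succ) z ≤
      clip H (I.reward h z + (expect (G.trans h z) (upperV I past h.succ) +
        2 * I.β * √(stepLeverage I Record.upper (upperV I) past h z))) := by
  rw [← inner_phiV_eq_expect hφ hG (upperV_mem I past h.succ)]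
  exact clip_mono (add_le_add_right (sSup_inner_confidenceSet_le hlam hβ (hgood h).1 _) _)

lemma clip_le_lowerQ (hlam : 0 < I.lam) (hβ : 0 ≤ I.β) (hφ : NormalizedFeature I.feature)
    (hG : IsKernelMixture G I.feature θ) (hgood : AllConfident I θ past) (h : Fin H)
    (z : S × A × A) :
    clip H (I.reward h z + (expect (G.trans h z) (lowerV I past h.succ) -
        2 * I.β * √(stepLeverage I Record.lower (lowerV I) past h z))) ≤
      lowerQ I (records I past) h (lowerV I past h.succ) z := by
  rw [← inner_phiV_eq_expect hφ hG (lowerV_mem I past h.succ)]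
  exact clip_mono (add_le_add_right (le_sInf_inner_confidenceSet hlam hβ (hgood h).2 _) _)

lemma abs_upperQ_le (I : AlgInput S A E H) (L : List (Record S A H)) (h : Fin H) (V : S → ℝ)
    (z : S × A × A) : |upperQ I L h V z| ≤ H := abs_clip_le _ _

lemma abs_lowerQ_le (I : AlgInput S A E H) (L : List (Record S A H)) (h : Fin H) (V : S → ℝ)
    (z : S × A × A) : |lowerQ I L h V z| ≤ H := abs_clip_le _ _

lemma expect_independentPlay {π ν : Policy S A H} {h : Fin H} {x : S} {f : A × A → ℝ} {c : ℝ}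
    (hf : ∀ p, |f p| ≤ c) :
    expect (independentPlay π ν h x) f =
      expect (π h x) fun a => expect (ν h x) fun b => f (a, b) := by
  rw [independentPlay, expect_bind hf]
  congr 1; funext a
  rw [expect_map hf]

lemma expect_independentPlay' {π ν : Policy S A H} {h : Fin H} {x : S} {f : A × A → ℝ} {c : ℝ}
    (hf : ∀ p, |f p| ≤ c) :
    expect (independentPlay π ν h x) f =
      expect (ν h x) fun b => expect (π h x) fun a => f (a, b) := by
  have : independentPlay π ν h x = (ν h x).bind fun b => (π h x).map fun a => (a, b) :=
    PMF.bind_comm (π h x) (ν h x) fun a b => PMF.pure (a, b)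
  rw [this, expect_bind hf]
  congr 1; funext a
  rw [expect_map hf]

/-- Independent play against the second marginal averages fixed deviations `a'`, each bounded by the
equilibrium inequality of the first player. -/
lemma expect_play_upperQ_le (hF : I.findCCE.Correct) (π : Policy S A H) (h : Fin H) (x : S) :
    expect (independentPlay π (minPolicy I past) h x) (fun p =>
      upperQ I (records I past) h (upperV I past h.succ) (x, p.1, p.2)) ≤
      upperV I past h.castSucc x := by
  rw [expect_independentPlay (fun _ => abs_upperQ_le _ _ _ _ _), upperV_castSucc]
  refine expect_le (fun _ => abs_expect_le fun _ => abs_upperQ_le _ _ _ _ _) fun a => ?_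
  exact (hF _ _ x).1 a

lemma le_expect_play_lowerQ (hF : I.findCCE.Correct) (ν : Policy S A H) (h : Fin H) (x : S) :
    lowerV I past h.castSucc x ≤
      expect (independentPlay (maxPolicy I past) ν h x) (fun p =>
        lowerQ I (records I past) h (lowerV I past h.succ) (x, p.1, p.2)) := by
  rw [expect_independentPlay' (fun _ => abs_lowerQ_le _ _ _ _ _), lowerV_castSucc]
  refine le_expect (fun _ => abs_expect_le fun _ => abs_lowerQ_le _ _ _ _ _) fun b => ?_
  exact (hF _ _ x).2 b

lemma abs_reward_le (G : MarkovGame S A H) (h : Fin H) (z : S × A × A) : |G.reward h z| ≤ 1 :=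
  abs_le.2 (G.reward_mem h z)

lemma abs_min_upperV_le (h : Fin (H + 1)) (x : S) :
    |min (upperV I past h x) ((H : ℝ) - (h : ℕ))| ≤ H := by
  have h1 := upperV_mem I past h x
  have h2 : ((h : ℕ) : ℝ) ≤ H := by exact_mod_cast Nat.lt_succ_iff.1 h.2
  exact abs_le.2 ⟨le_min h1.1 (by linarith [H.cast_nonneg (α := ℝ)]), (min_le_left _ _).trans h1.2⟩

lemma abs_max_lowerV_le (h : Fin (H + 1)) (x : S) :
    |max (lowerV I past h x) (-((H : ℝ) - (h : ℕ)))| ≤ H := by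
  have h1 := lowerV_mem I past h x
  have h2 : ((h : ℕ) : ℝ) ≤ H := by exact_mod_cast Nat.lt_succ_iff.1 h.2
  exact abs_le.2 ⟨h1.1.trans (le_max_left _ _), max_le h1.2 (by linarith [H.cast_nonneg (α := ℝ)])⟩

/-- The upper value dominates every response to the policy of the second player. -/
lemma policyValue_le_upperV (hlam : 0 < I.lam) (hβ : 0 ≤ I.β) (hφ : NormalizedFeature I.feature)
    (hG : IsKernelMixture G I.feature θ) (hr : I.reward = G.reward) (hF : I.findCCE.Correct)
    (hgood : AllConfident I θ past) (π : Policy S A H) (x : S) :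
    policyValue G π (minPolicy I past) x ≤ upperV I past 0 x := by
  refine (expect_trajectoryLaw_le _ _ x (abs_reward_le G)
    -- Clipping at `H` could break the Bellman inequality for `upperV` itself. Capping at the number
    -- of remaining steps keeps reward plus next value at most `H - h`, so the upper clip costs
    -- nothing.
    (U := fun h x => min (upperV I past h x) ((H : ℝ) - (h : ℕ))) abs_min_upperV_le ?_ ?_).trans
    (min_le_left _ _)
  · intro y; simp [upperV_last]
  intro h y
  have hU : ∀ y, |min (upperV I past h.succ y) ((H : ℝ) - (h.succ : ℕ))| ≤ H :=
    abs_min_upperV_le h.succ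
  have hb : ∀ ab : A × A, |G.reward h (y, ab.1, ab.2) + expect (G.trans h (y, ab.1, ab.2))
      fun x => min (upperV I past h.succ x) ((H : ℝ) - (h.succ : ℕ))| ≤ 1 + H := fun ab =>
    (abs_add_le _ _).trans (add_le_add (abs_reward_le G _ _) (abs_expect_le hU))
  have htop : ∀ ab : A × A, G.reward h (y, ab.1, ab.2) + expect (G.trans h (y, ab.1, ab.2))
      (fun x => min (upperV I past h.succ x) ((H : ℝ) - (h.succ : ℕ))) ≤ H - (h : ℕ) := by
    intro ab
    have h1 := (G.reward_mem h (y, ab.1, ab.2)).2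
    have h2 : expect (G.trans h (y, ab.1, ab.2))
      (fun x => min (upperV I past h.succ x) ((H : ℝ) - (h.succ : ℕ))) ≤ H - (h.succ : ℕ) :=
      expect_le hU fun x => min_le_right _ _
    rw [Fin.val_succ] at h2 ⊢
    push_cast at h2 ⊢
    linarith
  refine le_min ?_ (expect_le hb fun ab => htop ab)
  refine le_trans ?_ (expect_play_upperQ_le hF π h y)
  refine expect_mono hb (fun _ => abs_upperQ_le _ _ _ _ _) fun ab => ?_
  refine le_trans ?_ (clip_le_upperQ hlam hβ hφ hG hgood h _)
  rw [hr]
  refine le_clip ((htop ab).trans (by simp)) (add_le_add_right ?_ _)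
  exact expect_mono hU (fun x => abs_le.2 (upperV_mem I past _ x)) fun x => min_le_left _ _

/-- Mirror image of `policyValue_le_upperV`, with the floor `-(H - h)` against the clip at `-H`. -/
lemma lowerV_le_policyValue (hlam : 0 < I.lam) (hβ : 0 ≤ I.β) (hφ : NormalizedFeature I.feature)
    (hG : IsKernelMixture G I.feature θ) (hr : I.reward = G.reward) (hF : I.findCCE.Correct)
    (hgood : AllConfident I θ past) (ν : Policy S A H) (x : S) :
    lowerV I past 0 x ≤ policyValue G (maxPolicy I past) ν x := by
  refine (le_max_left _ _).trans (le_expect_trajectoryLaw _ _ x (abs_reward_le G)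
    (U := fun h x => max (lowerV I past h x) (-((H : ℝ) - (h : ℕ)))) abs_max_lowerV_le ?_ ?_)
  · intro y; simp [lowerV_last]
  intro h y
  have hU : ∀ y, |max (lowerV I past h.succ y) (-((H : ℝ) - (h.succ : ℕ)))| ≤ H :=
    abs_max_lowerV_le h.succ
  have hb : ∀ ab : A × A, |G.reward h (y, ab.1, ab.2) + expect (G.trans h (y, ab.1, ab.2))
      fun x => max (lowerV I past h.succ x) (-((H : ℝ) - (h.succ : ℕ)))| ≤ 1 + H := fun ab =>
    (abs_add_le _ _).trans (add_le_add (abs_reward_le G _ _) (abs_expect_le hU))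
  have hbot : ∀ ab : A × A, -((H : ℝ) - (h : ℕ)) ≤ G.reward h (y, ab.1, ab.2) +
      expect (G.trans h (y, ab.1, ab.2))
        (fun x => max (lowerV I past h.succ x) (-((H : ℝ) - (h.succ : ℕ)))) := by
    intro ab
    have h1 := (G.reward_mem h (y, ab.1, ab.2)).1
    have h2 : -((H : ℝ) - (h.succ : ℕ)) ≤ expect (G.trans h (y, ab.1, ab.2))
      (fun x => max (lowerV I past h.succ x) (-((H : ℝ) - (h.succ : ℕ)))) :=
      le_expect hU fun x => le_max_right _ _
    rw [Fin.val_succ] at h2 ⊢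
    push_cast at h2 ⊢
    linarith
  refine max_le ?_ (le_expect hb fun ab => hbot ab)
  refine (le_expect_play_lowerQ hF ν h y).trans ?_
  refine expect_mono (fun _ => abs_lowerQ_le _ _ _ _ _) hb fun ab => ?_
  refine (lowerQ_le_clip hlam hβ hφ hG hgood h _).trans ?_
  rw [hr]
  refine clip_le (le_trans (by simp) (hbot ab)) (add_le_add_right ?_ _)
  exact expect_mono (fun x => abs_le.2 (lowerV_mem I past _ x)) hU fun x => le_max_left _ _

lemma isApproxNash_of_gap_le [Nonempty A] (hlam : 0 < I.lam) (hβ : 0 ≤ I.β)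
    (hφ : NormalizedFeature I.feature)
    (hG : IsKernelMixture G I.feature θ) (hr : I.reward = G.reward) (hF : I.findCCE.Correct)
    (hgood : AllConfident I θ past) {x : S} {ε : ℝ}
    (hε : upperV I past 0 x - lowerV I past 0 x ≤ ε) :
    IsApproxNash G ε (maxPolicy I past) (minPolicy I past) x := by
  have : Nonempty (Policy S A H) := ⟨fun _ _ => PMF.pure (Classical.arbitrary A)⟩
  have h1 : bestMaxValue G (minPolicy I past) x ≤ upperV I past 0 x :=
    ciSup_le fun π => policyValue_le_upperV hlam hβ hφ hG hr hF hgood π x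
  have h2 : lowerV I past 0 x ≤ bestMinValue G (maxPolicy I past) x :=
    le_ciInf fun ν => lowerV_le_policyValue hlam hβ hφ hG hr hF hgood ν x
  unfold IsApproxNash
  linarith

lemma abs_policyValue_le (G : MarkovGame S A H) (π ν : Policy S A H) (x : S) :
    |policyValue G π ν x| ≤ H :=
  (abs_expect_le (abs_sum_reward_le (abs_reward_le G))).trans_eq (mul_one _)

lemma isApproxNash_of_two_mul_le [Nonempty A] (G : MarkovGame S A H) {ε : ℝ} (hε : 2 * H ≤ ε)
    (π ν : Policy S A H) (x : S) : IsApproxNash G ε π ν x := by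
  have : Nonempty (Policy S A H) := ⟨fun _ _ => PMF.pure (Classical.arbitrary A)⟩
  have h1 : bestMaxValue G ν x ≤ H :=
    ciSup_le fun π => (abs_le.1 (abs_policyValue_le G π ν x)).2
  have h2 : -(H : ℝ) ≤ bestMinValue G π x :=
    le_ciInf fun ν => (abs_le.1 (abs_policyValue_le G π ν x)).1
  unfold IsApproxNash
  linarith

/-- The bonus of a triplet: a bound on the difference between the upper and lower action values
that is not explained by the values at the next state. -/
def bonus (I : AlgInput S A E H) (past : List (Episode S A H)) (h : Fin H) (z : S × A × A) : ℝ :=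
  min (2 * H) (2 * I.β * √(stepLeverage I Record.upper (upperV I) past h z) +
    2 * I.β * √(stepLeverage I Record.lower (lowerV I) past h z))

lemma bonus_nonneg (hβ : 0 ≤ I.β) (h : Fin H) (z : S × A × A) : 0 ≤ bonus I past h z :=
  le_min (by positivity) (by positivity)

lemma abs_bonus_le (hβ : 0 ≤ I.β) (h : Fin H) (z : S × A × A) : |bonus I past h z| ≤ 2 * H := by
  rw [abs_of_nonneg (bonus_nonneg hβ h z)]
  exact min_le_left _ _

/-- The total bonus collected in the episode `e` played after the episodes `past`. -/
def episodeBonus (I : AlgInput S A E H) (past : List (Episode S A H)) (e : Episode S A H) : ℝ :=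
  ∑ h, bonus I past h (e h).triple

/-- The positive part makes the last term nonnegative, so the cap `2 H` is a valid bound by itself.
The other branch of the minimum adds the two widths, since clipping does not enlarge a difference
beyond a nonnegative bound. -/
lemma upperQ_sub_lowerQ_le (hlam : 0 < I.lam) (hβ : 0 ≤ I.β) (hφ : NormalizedFeature I.feature)
    (hG : IsKernelMixture G I.feature θ) (hgood : AllConfident I θ past) (h : Fin H)
    (z : S × A × A) :
    upperQ I (records I past) h (upperV I past h.succ) z -
        lowerQ I (records I past) h (lowerV I past h.succ) z ≤
      bonus I past h z + expect (G.trans h z) fun y =>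
        max 0 (upperV I past h.succ y - lowerV I past h.succ y) := by
  have hU : ∀ y, |upperV I past h.succ y| ≤ H := fun y => abs_le.2 (upperV_mem I past _ y)
  have hL : ∀ y, |lowerV I past h.succ y| ≤ H := fun y => abs_le.2 (lowerV_mem I past _ y)
  have hUL : ∀ y, |upperV I past h.succ y - lowerV I past h.succ y| ≤ H + H := fun y =>
    (abs_sub _ _).trans (add_le_add (hU y) (hL y))
  have hm : ∀ y, |max 0 (upperV I past h.succ y - lowerV I past h.succ y)| ≤ H + H := fun y => by
    rw [abs_of_nonneg (le_max_left _ _)]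
    exact max_le (by positivity) ((le_abs_self _).trans (hUL y))
  have h0 : 0 ≤ expect (G.trans h z) fun y =>
      max 0 (upperV I past h.succ y - lowerV I past h.succ y) :=
    le_expect hm fun y => le_max_left _ _
  have h1 := expect_mono (p := G.trans h z) hUL hm fun y => le_max_right _ _
  rw [expect_sub hU hL] at h1
  have h2 := upperQ_le_clip hlam hβ hφ hG hgood h z
  have h3 := clip_le_lowerQ hlam hβ hφ hG hgood h z
  rw [bonus, ← min_add_add_right]
  refine le_min ?_ ?_
  · have := (upperQ_mem I (records I past) h (upperV I past h.succ) z).2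
    have := (lowerQ_mem I (records I past) h (lowerV I past h.succ) z).1
    linarith
  · refine le_trans (sub_le_sub h2 h3) (clip_sub_clip_le (by positivity) ?_)
    linarith

/-- The estimated gap is at most the expected total bonus of the next episode. -/
lemma gap_le_expect_episodeBonus (hlam : 0 < I.lam) (hβ : 0 ≤ I.β)
    (hφ : NormalizedFeature I.feature)
    (hG : IsKernelMixture G I.feature θ) (hgood : AllConfident I θ past) (x : S) :
    upperV I past 0 x - lowerV I past 0 x ≤
      expect (trajectoryLaw (jointPolicy I past) G.trans x) (episodeBonus I past) := by
  have hm : ∀ (h : Fin (H + 1)) y, |max 0 (upperV I past h y - lowerV I past h y)| ≤ H + H := by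
    intro h y
    have h1 := upperV_mem I past h y
    have h2 := lowerV_mem I past h y
    rw [abs_of_nonneg (le_max_left _ _)]
    exact max_le (by positivity) (by linarith [h1.2, h2.1])
  refine (le_max_right 0 _).trans (le_expect_trajectoryLaw _ _ x (abs_bonus_le hβ)
    (U := fun h y => max 0 (upperV I past h y - lowerV I past h y)) hm ?_ ?_)
  · intro y; simp [upperV_last, lowerV_last]
  intro h y
  have hb : ∀ ab : A × A, |bonus I past h (y, ab.1, ab.2) + expect (G.trans h (y, ab.1, ab.2))
      fun y => max 0 (upperV I past h.succ y - lowerV I past h.succ y)| ≤ 2 * H + (H + H) :=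
    fun ab => (abs_add_le _ _).trans (add_le_add (abs_bonus_le hβ _ _) (abs_expect_le (hm h.succ)))
  refine max_le (le_expect hb fun ab => add_nonneg (bonus_nonneg hβ _ _)
    (le_expect (hm h.succ) fun y => le_max_left _ _)) ?_
  rw [upperV_castSucc, lowerV_castSucc, ← expect_sub (fun _ => abs_upperQ_le _ _ _ _ _)
    (fun _ => abs_lowerQ_le _ _ _ _ _)]
  exact expect_mono (fun ab => (abs_sub _ _).trans
    (add_le_add (abs_upperQ_le _ _ _ _ _) (abs_lowerQ_le _ _ _ _ _))) hb
    fun ab => upperQ_sub_lowerQ_le hlam hβ hφ hG hgood h _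

end Optimism

/-! ### The sum of the bonuses over a run -/

section Bonus

open scoped ENNReal

variable {S A E : Type*} [NormedAddCommGroup E] [InnerProductSpace ℝ E] {H : ℕ}
  {I : AlgInput S A E H} {G : MarkovGame S A H} {θ : Fin H → E} {x₁ : S}

/-- The sum over the episodes of a run of a quantity that depends on the episode and its past. -/
def runSum (f : List (Episode S A H) → Episode S A H → ℝ) : List (Episode S A H) → ℝ
  | [] => 0
  | e :: past => runSum f past + f past e

lemma runSum_mono {f g : List (Episode S A H) → Episode S A H → ℝ} {run : List (Episode S A H)}
    (h : ∀ past e, (e :: past) <:+ run → f past e ≤ g past e) : runSum f run ≤ runSum g run := by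
  induction run with
  | nil => exact le_refl _
  | cons e past ih =>
    exact add_le_add (ih fun p e' hp => h p e' (hp.trans (List.suffix_cons e past)))
      (h past e List.suffix_rfl)

lemma runSum_const (c : ℝ) (run : List (Episode S A H)) :
    runSum (fun _ _ => c) run = run.length * c := by
  induction run with
  | nil => simp [runSum]
  | cons e past ih => rw [runSum, ih, List.length_cons]; push_cast; ring

lemma runSum_sum (f : Fin H → List (Episode S A H) → Episode S A H → ℝ)
    (run : List (Episode S A H)) :
    runSum (fun past e => ∑ h, f h past e) run = ∑ h, runSum (f h) run := by
  induction run with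
  | nil => simp [runSum]
  | cons e past ih => simp only [runSum, ih, Finset.sum_add_distrib]

lemma runSum_add (f g : List (Episode S A H) → Episode S A H → ℝ) (run : List (Episode S A H)) :
    runSum (fun past e => f past e + g past e) run = runSum f run + runSum g run := by
  induction run with
  | nil => simp [runSum]
  | cons e past ih => simp only [runSum, ih]; ring

lemma runSum_mul_left (c : ℝ) (f : List (Episode S A H) → Episode S A H → ℝ)
    (run : List (Episode S A H)) :
    runSum (fun past e => c * f past e) run = c * runSum f run := by
  induction run with
  | nil => simp [runSum]
  | cons e past ih => simp only [runSum, ih]; ring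

/-- With `y = min 1 x`, `log (1 + y) ≥ y / (1 + y) ≥ y / 2`. -/
lemma min_one_le_log {x : ℝ} (hx : 0 ≤ x) : min 1 x ≤ 2 * Real.log (1 + x) := by
  have h1 : Real.log (1 + min 1 x) ≤ Real.log (1 + x) :=
    Real.log_le_log (by positivity) (by linarith [min_le_right 1 x])
  have h0 : 0 ≤ min 1 x := le_min zero_le_one hx
  have h2 := Real.one_sub_inv_le_log_of_pos (show 0 < 1 + min 1 x by linarith)
  have h3 : min 1 x / 2 ≤ 1 - (1 + min 1 x)⁻¹ := by
    have : (1 : ℝ) - (1 + min 1 x)⁻¹ = min 1 x / (1 + min 1 x) := by field_simp; ring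
    rw [this]
    exact div_le_div_of_nonneg_left h0 (by linarith) (by linarith [min_le_left 1 x])
  linarith

/-- The elliptical potential lemma. -/
lemma runSum_min_stepLeverage_le (hlam : 0 < I.lam) {est : Record S A H → Fin (H + 1) → S → ℝ}
    {V : List (Episode S A H) → Fin (H + 1) → S → ℝ} (hV : IsEstimate I est V) (h : Fin H)
    (run : List (Episode S A H)) :
    runSum (fun past e => min 1 (stepLeverage I est V past h (e h).triple)) run ≤
      2 * Real.log (leverageProd I.lam ((pastData I est h run).map Prod.fst)) := by
  induction run with
  | nil => simp [runSum, pastData, regressionData, records, leverageProd]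
  | cons e past ih =>
    have h1 := leverageProd_one_le hlam ((pastData I est h past).map Prod.fst)
    have h2 := leverage_nonneg hlam ((pastData I est h past).map Prod.fst)
      (phiV I.feature (V past h.succ) (e h).triple)
    rw [runSum, pastData_cons hV, List.map_cons, leverageProd,
      Real.log_mul (by linarith) (by linarith), mul_add]
    exact add_le_add ih (min_one_le_log h2)

/-- The arithmetic–geometric mean inequality with a free parameter `s`, which replaces
Cauchy–Schwarz over the episodes once `s` is optimized. -/
lemma min_one_sqrt_le {x s : ℝ} (hx : 0 ≤ x) (hs : 0 < s) :
    min 1 √x ≤ s / 2 + 1 / (2 * s) * min 1 x := by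
  have h1 : min 1 x = (min 1 √x) ^ 2 := by
    rcases le_total 1 x with h | h
    · rw [min_eq_left h, min_eq_left (by rwa [Real.one_le_sqrt]), one_pow]
    · rw [min_eq_right h, min_eq_right (by rwa [Real.sqrt_le_one]), Real.sq_sqrt hx]
  rw [h1]
  generalize min 1 √x = y
  have : s / 2 + 1 / (2 * s) * y ^ 2 - y = (s - y) ^ 2 / (2 * s) := by field_simp; ring
  have h2 : 0 ≤ (s - y) ^ 2 / (2 * s) := by positivity
  linarith

/-- Since `H ≤ β`, the cap `2 H` is at most `2 β`, so each width can be truncated at one separately,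
as the potential argument needs. -/
lemma bonus_le (hβ : (H : ℝ) ≤ I.β) (past : List (Episode S A H)) (h : Fin H) (z : S × A × A) :
    bonus I past h z ≤
      2 * I.β * min 1 √(stepLeverage I Record.upper (upperV I) past h z) +
      2 * I.β * min 1 √(stepLeverage I Record.lower (lowerV I) past h z) := by
  have h0 : (0 : ℝ) ≤ I.β := (Nat.cast_nonneg H).trans hβ
  set a := √(stepLeverage I Record.upper (upperV I) past h z)
  set b := √(stepLeverage I Record.lower (lowerV I) past h z)
  have ha : 0 ≤ a := Real.sqrt_nonneg _
  have hb : 0 ≤ b := Real.sqrt_nonneg _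
  rcases le_total 1 a with h1 | h1
  · rw [min_eq_left h1]
    have : 0 ≤ 2 * I.β * min 1 b := by positivity
    exact (min_le_left _ _).trans (by linarith)
  rcases le_total 1 b with h2 | h2
  · rw [min_eq_left h2]
    have : 0 ≤ 2 * I.β * min 1 a := by positivity
    exact (min_le_left _ _).trans (by linarith)
  · rw [min_eq_right h1, min_eq_right h2]
    exact min_le_right _ _

lemma runSum_min_sqrt_le (hlam : 0 < I.lam) (hφ : NormalizedFeature I.feature)
    {est : Record S A H → Fin (H + 1) → S → ℝ}
    {V : List (Episode S A H) → Fin (H + 1) → S → ℝ} (hV : IsEstimate I est V) (h : Fin H)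
    (run : List (Episode S A H)) (z₀ : S × A × A) {s : ℝ} (hs : 0 < s) :
    runSum (fun past e => min 1 √(stepLeverage I est V past h (e h).triple)) run ≤
      run.length * (s / 2) + 1 / (2 * s) * (4 * effDim I.feature H run.length I.lam) := by
  have h1 : runSum (fun past e => min 1 √(stepLeverage I est V past h (e h).triple)) run ≤
      runSum (fun past e => s / 2 +
        1 / (2 * s) * min 1 (stepLeverage I est V past h (e h).triple)) run :=
    runSum_mono fun past e _ => min_one_sqrt_le (leverage_nonneg hlam _ _) hs
  rw [runSum_add, runSum_const, runSum_mul_left] at h1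
  refine h1.trans (add_le_add_right (mul_le_mul_of_nonneg_left ?_ (by positivity)) _)
  have h2 := runSum_min_stepLeverage_le hlam hV h run
  have h3 := log_leverageProd_pastData_le hlam hφ hV h (le_refl run.length) z₀
  linarith

/-- The sum of the bonuses over a run of `T` episodes is at most `8 β H √(T Γ)`. -/
lemma runSum_episodeBonus_le (hlam : 0 < I.lam) (hβ : (H : ℝ) ≤ I.β)
    (hφ : NormalizedFeature I.feature) {run : List (Episode S A H)} (hrun : 1 ≤ run.length)
    (z₀ : S × A × A) (hΓ : 0 < effDim I.feature H run.length I.lam) :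
    runSum (episodeBonus I) run ≤
      8 * I.β * H * √(run.length * effDim I.feature H run.length I.lam) := by
  set Γ := effDim I.feature H run.length I.lam with hΓdef
  have hT : (0 : ℝ) < run.length := by exact_mod_cast hrun
  have h0 : (0 : ℝ) ≤ I.β := (Nat.cast_nonneg H).trans hβ
  set w := √(run.length * Γ) with hw
  have hwpos : 0 < w := Real.sqrt_pos.2 (by positivity)
  have hsq : w ^ 2 = run.length * Γ := Real.sq_sqrt (by positivity)
  -- The minimizer of `T s / 2 + 2 Γ / s`, with minimum `2 w`. Two estimates, each with factor `2
  -- β`, give `8 β w` per step.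
  have hs : 0 < 2 * w / run.length := by positivity
  have hval : run.length * (2 * w / run.length / 2) + 1 / (2 * (2 * w / run.length)) * (4 * Γ) =
      2 * w := by
    field_simp
    rw [hsq]; ring
  have h1 : runSum (episodeBonus I) run ≤ runSum (fun past e => ∑ h : Fin H,
      (2 * I.β * min 1 √(stepLeverage I Record.upper (upperV I) past h (e h).triple) +
      2 * I.β * min 1 √(stepLeverage I Record.lower (lowerV I) past h (e h).triple))) run :=
    runSum_mono fun past e _ => Finset.sum_le_sum fun h _ => bonus_le hβ past h _
  rw [runSum_sum] at h1
  refine h1.trans ?_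
  have h2 : ∀ h : Fin H, runSum (fun past e =>
      2 * I.β * min 1 √(stepLeverage I Record.upper (upperV I) past h (e h).triple) +
      2 * I.β * min 1 √(stepLeverage I Record.lower (lowerV I) past h (e h).triple)) run ≤
      8 * I.β * w := by
    intro h
    rw [runSum_add, runSum_mul_left, runSum_mul_left]
    have hu := runSum_min_sqrt_le hlam hφ (isEstimate_upper I) h run z₀ hs
    have hl := runSum_min_sqrt_le hlam hφ (isEstimate_lower I) h run z₀ hs
    rw [← hΓdef, hval] at hu hl
    have hu' := mul_le_mul_of_nonneg_left hu (by positivity : 0 ≤ 2 * I.β)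
    have hl' := mul_le_mul_of_nonneg_left hl (by positivity : 0 ≤ 2 * I.β)
    linarith
  refine (Finset.sum_le_sum fun h _ => h2 h).trans (le_of_eq ?_)
  simp only [Finset.sum_const, Finset.card_univ, Fintype.card_fin, nsmul_eq_mul]
  ring

lemma exp_neg_le_one_sub_half {y : ℝ} (h0 : 0 ≤ y) (h1 : y ≤ 1) : Real.exp (-y) ≤ 1 - y / 2 := by
  rw [Real.exp_neg, inv_le_iff_one_le_mul₀ (Real.exp_pos y)]
  have := Real.add_one_le_exp y
  have h2 : (1 : ℝ) ≤ (1 - y / 2) * (y + 1) := by nlinarith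
  exact h2.trans (mul_le_mul_of_nonneg_left this (by linarith))

/-- A nonnegative bounded random variable has a one-sided exponential moment bound. -/
lemma lexpect_exp_half_sub_le {α : Type*} {p : PMF α} {Y : α → ℝ} {R : ℝ} (hR : 0 < R)
    (h0 : ∀ a, 0 ≤ Y a) (h1 : ∀ a, Y a ≤ R) :
    lexpect p (fun a => ENNReal.ofReal (Real.exp ((expect p Y / 2 - Y a) / R))) ≤ 1 := by
  have hY : ∀ a, |Y a / R| ≤ 1 := fun a => by
    rw [abs_of_nonneg (div_nonneg (h0 a) hR.le)]
    exact (div_le_one hR).2 (h1 a)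
  have hb : ∀ a, |1 - Y a / R / 2| ≤ 2 := fun a => by
    have := abs_le.1 (hY a)
    exact abs_le.2 ⟨by linarith, by linarith⟩
  -- Linearizing `exp (-Y / R) ≤ 1 - Y / (2 R)` keeps only half the mean. In exchange the deviation
  -- term over a run does not grow with the number of episodes.
  have hpt : ∀ a, ENNReal.ofReal (Real.exp ((expect p Y / 2 - Y a) / R)) ≤
      ENNReal.ofReal (Real.exp (expect p Y / R / 2)) * ENNReal.ofReal (1 - Y a / R / 2) := by
    intro a
    rw [← ENNReal.ofReal_mul (Real.exp_pos _).le]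
    refine ENNReal.ofReal_le_ofReal ?_
    rw [show (expect p Y / 2 - Y a) / R = expect p Y / R / 2 + -(Y a / R) by ring, Real.exp_add]
    exact mul_le_mul_of_nonneg_left (exp_neg_le_one_sub_half (div_nonneg (h0 a) hR.le)
      ((div_le_one hR).2 (h1 a))) (Real.exp_pos _).le
  have hmean : expect p (fun a => 1 - Y a / R / 2) = 1 - expect p Y / R / 2 := by
    have hd : ∀ a, |Y a / R / 2| ≤ 1 := fun a => by
      have := abs_le.1 (hY a)
      exact abs_le.2 ⟨by linarith, by linarith⟩
    rw [expect_sub (fun _ => le_refl |1|) hd, expect_const]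
    congr 1
    rw [show (fun a => Y a / R / 2) = fun a => (1 / R / 2) * Y a by funext a; ring,
      expect_mul_left]
    ring
  refine (lexpect_mono p hpt).trans ?_
  rw [lexpect_mul_left, lexpect_ofReal hb fun a => by linarith [(abs_le.1 (hY a)).2], hmean,
    ← ENNReal.ofReal_mul (Real.exp_pos _).le, ← ENNReal.ofReal_one]
  refine ENNReal.ofReal_le_ofReal ?_
  have := Real.add_one_le_exp (-(expect p Y / R / 2))
  calc Real.exp (expect p Y / R / 2) * (1 - expect p Y / R / 2)
      ≤ Real.exp (expect p Y / R / 2) * Real.exp (-(expect p Y / R / 2)) :=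
        mul_le_mul_of_nonneg_left (by linarith) (Real.exp_pos _).le
    _ = 1 := by rw [← Real.exp_add, add_neg_cancel, Real.exp_zero]

lemma episodeBonus_nonneg (hβ : 0 ≤ I.β) (past : List (Episode S A H)) (e : Episode S A H) :
    0 ≤ episodeBonus I past e := Finset.sum_nonneg fun h _ => bonus_nonneg hβ h _

lemma episodeBonus_le (hβ : 0 ≤ I.β) (past : List (Episode S A H)) (e : Episode S A H) :
    episodeBonus I past e ≤ 2 * (H : ℝ) ^ 2 :=
  (le_abs_self _).trans ((abs_sum_reward_le (abs_bonus_le hβ) e).trans_eq (by ring))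

/-- The expectation of the total bonus of the episode that follows `past`. -/
def meanBonus (I : AlgInput S A E H) (G : MarkovGame S A H) (x₁ : S)
    (past : List (Episode S A H)) : ℝ :=
  expect (trajectoryLaw (jointPolicy I past) G.trans x₁) (episodeBonus I past)

/-- With high probability the conditional expectations of the bonuses are controlled by the
bonuses themselves. -/
lemma toOuterMeasure_meanBonus_le (hH : 1 ≤ H) (hβ : 0 ≤ I.β) (T : ℕ) (c : ℝ) :
    (runLaw I G.trans x₁ T).toOuterMeasure {run | 2 * runSum (episodeBonus I) run +
      4 * (H : ℝ) ^ 2 * c ≤ runSum (fun past _ => meanBonus I G x₁ past) run} ≤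
    ENNReal.ofReal (Real.exp (-c)) := by
  have hH' : (0 : ℝ) < H := by exact_mod_cast hH
  have hR : (0 : ℝ) < 2 * H ^ 2 := by positivity
  -- Only the final time matters here, so Markov's inequality suffices. The scale `2 H ^ 2` bounds
  -- the total bonus of an episode.
  have hsup := lexpect_runLaw_le (I := I) (P := G.trans) (x₁ := x₁)
    (M := fun run => ENNReal.ofReal (Real.exp
      (runSum (fun past e => (meanBonus I G x₁ past / 2 - episodeBonus I past e) / (2 * H ^ 2))
        run))) (by simp [runSum]) (fun past => by
      simp only [runSum, Real.exp_add, ENNReal.ofReal_mul (Real.exp_pos _).le]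
      rw [lexpect_mul_left]
      exact mul_le_of_le_one_right' (lexpect_exp_half_sub_le hR (episodeBonus_nonneg hβ past)
        (episodeBonus_le hβ past))) T
  rw [Real.exp_neg, ENNReal.ofReal_inv_of_pos (Real.exp_pos _)]
  rw [ENNReal.le_inv_iff_mul_le, mul_comm]
  refine (toOuterMeasure_le_lexpect _ ?_).trans hsup
  intro run hrun
  refine ENNReal.ofReal_le_ofReal (Real.exp_le_exp.2 ?_)
  have e : runSum (fun past e => (meanBonus I G x₁ past / 2 - episodeBonus I past e) /
      (2 * H ^ 2)) run = runSum (fun past _ => meanBonus I G x₁ past) run * (1 / (4 * H ^ 2)) -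
        runSum (episodeBonus I) run * (1 / (2 * H ^ 2)) := by
    rw [show (fun past e => (meanBonus I G x₁ past / 2 - episodeBonus I past e) / (2 * H ^ 2)) =
      fun past e => (1 / (4 * (H : ℝ) ^ 2)) * meanBonus I G x₁ past +
        (-(1 / (2 * (H : ℝ) ^ 2))) * episodeBonus I past e by funext past e; ring,
      runSum_add, runSum_mul_left, runSum_mul_left]
    ring
  rw [e]
  have hrun' : 2 * runSum (episodeBonus I) run + 4 * (H : ℝ) ^ 2 * c ≤
      runSum (fun past _ => meanBonus I G x₁ past) run := hrun
  have := mul_le_mul_of_nonneg_right hrun' (by positivity : 0 ≤ 1 / (4 * (H : ℝ) ^ 2))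
  have e2 : (2 * runSum (episodeBonus I) run + 4 * (H : ℝ) ^ 2 * c) * (1 / (4 * (H : ℝ) ^ 2)) =
    runSum (episodeBonus I) run * (1 / (2 * H ^ 2)) + c := by field_simp; ring
  linarith

/-- A lower bound for the estimated gaps of all episodes is bounded through the bonuses. -/
lemma length_mul_le_of_le_estimatedGap (hlam : 0 < I.lam) (hβ : 0 ≤ I.β)
    (hφ : NormalizedFeature I.feature) (hG : IsKernelMixture G I.feature θ)
    {run : List (Episode S A H)} (hgood : ∀ past, past <:+ run → AllConfident I θ past) {g : ℝ}
    (hg : ∀ t < run.length, g ≤ estimatedGap I x₁ run t) :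
    run.length * g ≤ runSum (fun past _ => meanBonus I G x₁ past) run := by
  rw [← runSum_const g run]
  refine runSum_mono fun past e hs => ?_
  have hs' : past <:+ run := (List.suffix_cons e past).trans hs
  have hlt : past.length < run.length := by
    have := hs.length_le
    simp at this; omega
  have h1 := hg past.length hlt
  have h2 : before run past.length = past := (List.suffix_iff_eq_drop.1 hs').symm
  rw [estimatedGap, h2] at h1
  exact h1.trans (gap_le_expect_episodeBonus hlam hβ hφ hG (hgood past hs') x₁)

end Bonus

/-! ### Sample complexity -/

section Arithmetic

variable {H T B β δ ε lam Γ : ℝ}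

/-- Uses `lam ≤ 2`, hence `lam⁻¹ ≥ 1 / 2`, and `min_one_le_log`. -/
lemma quarter_min_le_of_log_le (hT : 1 ≤ T) (hlam : lam = 1 + 1 / T) (hB : 0 < B)
    (hΓ : 1 / 2 * Real.log (1 + T * (lam⁻¹ * (H / B) ^ 2)) ≤ Γ) :
    min 1 (T * H ^ 2 / (2 * B ^ 2)) ≤ 4 * Γ := by
  have hl1 : 1 ≤ lam := by rw [hlam]; linarith [show (0 : ℝ) ≤ 1 / T by positivity]
  have hl2 : lam ≤ 2 := by rw [hlam]; linarith [(div_le_one (by linarith : 0 < T)).2 hT]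
  have hx : T * H ^ 2 / (2 * B ^ 2) ≤ T * (lam⁻¹ * (H / B) ^ 2) := by
    have h1 : (2 : ℝ)⁻¹ ≤ lam⁻¹ := inv_anti₀ (by linarith) hl2
    have h2 : T * H ^ 2 / (2 * B ^ 2) = T * (2⁻¹ * (H / B) ^ 2) := by field_simp
    rw [h2]
    gcongr
  have h3 := min_one_le_log (x := T * (lam⁻¹ * (H / B) ^ 2)) (by positivity)
  have h4 := min_le_min_left 1 hx
  linarith

/-- If the number of episodes is large enough, then either the accuracy `ε` is trivial or it
dominates the average bonus. -/
lemma accuracy_trivial_or_le (hH : 1 ≤ H) (hT : 1 ≤ T) (hδ : 0 < δ) (hδ1 : δ < 1) (hε : 0 < ε)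
    (_hβ : 0 < β) (hlam : lam = 1 + 1 / T) (hB : 0 < B) (hΓ0 : 0 < Γ)
    (hΓ : min 1 (T * H ^ 2 / (2 * B ^ 2)) ≤ 4 * Γ)
    (hL : 2 * Γ + 2 + 4 * Real.log (H / δ) + 2 * lam * (B / H) ^ 2 ≤ (β / H) ^ 2)
    (hC : 1024 * (β ^ 2 * H ^ 2 * Γ / ε ^ 2) ≤ T) :
    2 * H ≤ ε ∨ 16 * β * H * √(T * Γ) + 4 * H ^ 2 * Real.log (4 / δ) ≤ T * ε := by
  have hH0 : 0 < H := by linarith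
  have hT0 : 0 < T := by linarith
  have hl1 : 1 ≤ lam := by rw [hlam]; linarith [show (0 : ℝ) ≤ 1 / T by positivity]
  have hlogpos : 0 ≤ Real.log (H / δ) :=
    Real.log_nonneg (by rw [le_div_iff₀ hδ]; linarith)
  have hmain : 1024 * (β ^ 2 * H ^ 2 * Γ) ≤ T * ε ^ 2 := by
    rwa [← mul_div_assoc, div_le_iff₀ (by positivity)] at hC
  have hBH : 0 ≤ (B / H) ^ 2 := by positivity
  have hL' : (2 * Γ + 2 + 4 * Real.log (H / δ) + 2 * lam * (B / H) ^ 2) * H ^ 2 ≤ β ^ 2 := by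
    rwa [div_pow β H, le_div_iff₀ (by positivity)] at hL
  have htriv : 256 * H ^ 4 ≤ ε ^ 2 → 2 * H ≤ ε := by
    intro h
    have h1 : (16 * H ^ 2) ^ 2 ≤ ε ^ 2 := by nlinarith
    have h2 := (abs_le_of_sq_le_sq' h1 hε.le).2
    nlinarith
  -- If `T H² ≤ 2 B²`, then `2 B² ≤ β²` gives `T H² ≤ 4 Γ β²`, and the episode count forces `256 H⁴
  -- ≤ ε²`, a trivial accuracy. Otherwise `Γ ≥ 1 / 4`.
  rcases le_total (T * H ^ 2 / (2 * B ^ 2)) 1 with hx | hx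
  · left
    rw [min_eq_right hx, div_le_iff₀ (by positivity)] at hΓ
    have hβB : 2 * B ^ 2 ≤ β ^ 2 := by
      have h1 : 2 * (B / H) ^ 2 ≤ 2 * Γ + 2 + 4 * Real.log (H / δ) + 2 * lam * (B / H) ^ 2 := by
        nlinarith
      have h2 := mul_le_mul_of_nonneg_right h1 (sq_nonneg H)
      have h3 : 2 * (B / H) ^ 2 * H ^ 2 = 2 * B ^ 2 := by field_simp
      linarith
    apply htriv
    have h1 : T * H ^ 2 ≤ 4 * Γ * β ^ 2 := hΓ.trans (by gcongr)
    have h2 := mul_le_mul_of_nonneg_left h1 (sq_nonneg H)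
    have h3 : T * (256 * H ^ 4) ≤ T * ε ^ 2 := by nlinarith
    exact le_of_mul_le_mul_left h3 hT0
  · rw [min_eq_left hx] at hΓ
    set l := Real.log (4 / δ) with hl
    have hlpos : 0 ≤ l := Real.log_nonneg (by rw [le_div_iff₀ hδ]; linarith)
    have hlle : l ≤ 2 + 4 * Real.log (H / δ) := by
      have h1 : Real.log (1 / δ) ≤ Real.log (H / δ) :=
        Real.log_le_log (by positivity) (by gcongr)
      have h2 : l = 2 * Real.log 2 + Real.log (1 / δ) := by
        rw [hl, show 4 / δ = 2 ^ 2 * (1 / δ) by ring, Real.log_mul (by norm_num) (by positivity),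
          Real.log_pow]
        norm_num
      linarith [Real.log_two_lt_d9]
    have hβl : l * H ^ 2 ≤ β ^ 2 := by
      refine le_trans (mul_le_mul_of_nonneg_right ?_ (sq_nonneg H)) hL'
      have : 0 ≤ 2 * lam * (B / H) ^ 2 := by positivity
      linarith
    have hεl : 256 * H ^ 4 * l ≤ T * ε ^ 2 := by
      have h1 : l * H ^ 2 * 1 ≤ β ^ 2 * (4 * Γ) :=
        mul_le_mul hβl hΓ zero_le_one (sq_nonneg β)
      have h2 := mul_le_mul_of_nonneg_left h1 (sq_nonneg H)
      nlinarith
    -- For `T ≤ l` the bound `hεl` again makes the accuracy trivial. Otherwise each of the two terms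
    -- is at most `T ε / 2`; the constant `1024 = 32 ^ 2` is chosen for the first.
    rcases le_total T l with hTl | hTl
    · left
      apply htriv
      have h1 : T * (256 * H ^ 4) ≤ l * (256 * H ^ 4) :=
        mul_le_mul_of_nonneg_right hTl (by positivity)
      exact le_of_mul_le_mul_left (by linarith) hT0
    · right
      have h1 : 32 * β * H * √(T * Γ) ≤ T * ε := by
        refine (abs_le_of_sq_le_sq' ?_ (by positivity)).2
        rw [mul_pow, Real.sq_sqrt (by positivity)]
        have := mul_le_mul_of_nonneg_left hmain hT0.le
        nlinarith
      have h2 : 8 * H ^ 2 * l ≤ T * ε := by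
        refine (abs_le_of_sq_le_sq' ?_ (by positivity)).2
        have h3 := mul_le_mul_of_nonneg_left hεl hT0.le
        have h4 : H ^ 4 * l * l ≤ H ^ 4 * l * T :=
          mul_le_mul_of_nonneg_left hTl (by positivity)
        nlinarith [show 0 ≤ H ^ 4 * l * T by positivity]
      linarith

/-- The squared confidence radius is of the order of `(1 + log (H / δ)) Γ`. -/
lemma bonusLevel_bound (hH : 1 ≤ H) (hT : 1 ≤ T) (hδ : 0 < δ) (hδ1 : δ < 1)
    (hlam : lam = 1 + 1 / T) (hB : 0 < B)
    (hΓ : min 1 (T * H ^ 2 / (2 * B ^ 2)) ≤ 4 * Γ) :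
    2 * Γ + 2 + 4 * Real.log (H / δ) + 2 * lam * (B / H) ^ 2 ≤
      (2 + (4 + 4 * B ^ 2) * (4 * (2 * B ^ 2 + 1))) * ((1 + Real.log (H / δ)) * Γ) := by
  have hl2 : lam ≤ 2 := by rw [hlam]; linarith [(div_le_one (by linarith : 0 < T)).2 hT]
  have hlogpos : 0 ≤ Real.log (H / δ) :=
    Real.log_nonneg (by rw [le_div_iff₀ hδ]; linarith)
  -- As `T H² ≥ 1`, `Γ` is bounded below in terms of `B` alone, so the terms of the bonus level
  -- without `Γ` can be absorbed into multiples of it.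
  have hK : 1 ≤ 4 * (2 * B ^ 2 + 1) * Γ := by
    have h1 : 1 / (2 * B ^ 2 + 1) ≤ min 1 (T * H ^ 2 / (2 * B ^ 2)) := by
      refine le_min ?_ ?_
      · rw [div_le_one (by positivity)]; nlinarith
      · have : 1 ≤ T * H ^ 2 := one_le_mul_of_one_le_of_one_le hT (one_le_pow₀ hH)
        gcongr
        linarith
    have h2 := h1.trans hΓ
    rw [div_le_iff₀ (by positivity)] at h2
    linarith
  have hBH : (B / H) ^ 2 ≤ B ^ 2 := by
    refine pow_le_pow_left₀ (by positivity) (div_le_self hB.le hH) 2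
  have h3 : 2 * lam * (B / H) ^ 2 ≤ 4 * B ^ 2 := by
    have : 2 * lam * (B / H) ^ 2 ≤ 2 * 2 * B ^ 2 := by gcongr
    linarith
  set l := Real.log (H / δ)
  have hΓ0 : 0 ≤ Γ := by
    have : 0 ≤ min 1 (T * H ^ 2 / (2 * B ^ 2)) := by positivity
    linarith
  have h4 : (4 + 4 * B ^ 2) * 1 ≤ (4 + 4 * B ^ 2) * (4 * (2 * B ^ 2 + 1) * Γ) :=
    mul_le_mul_of_nonneg_left hK (by positivity)
  have h5 := mul_le_mul_of_nonneg_left h4 (by linarith : 0 ≤ 1 + l)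
  have h6 : 0 ≤ l * Γ := by positivity
  have h7 : 0 ≤ l * B ^ 2 := by positivity
  nlinarith

end Arithmetic

/-! ### The union bound over the failure events -/

section Main

variable {S A E : Type*} [Nonempty A] [NormedAddCommGroup E] [InnerProductSpace ℝ E]
  {H T : ℕ} {G : MarkovGame S A H} {φ : S × A × A → S → E} {θ : Fin H → E} {B δ lam : ℝ}

lemma exists_effDim_lower_bound (hH : 1 ≤ H) (hT : 1 ≤ T) (hlam : lam = 1 + 1 / (T : ℝ))
    (hφ : NormalizedFeature φ) (hG : IsKernelMixture G φ θ) (hθ : ∀ h, ‖θ h‖ ≤ B) (x₁ : S) :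
    0 < B ∧ 0 < effDim φ H T lam ∧
      min 1 (T * (H : ℝ) ^ 2 / (2 * B ^ 2)) ≤ 4 * effDim φ H T lam := by
  have hT0 : (0 : ℝ) < T := by exact_mod_cast hT
  have hH0 : (0 : ℝ) < H := by exact_mod_cast hH
  have hl : 0 < lam := by rw [hlam]; positivity
  let a : A := Classical.arbitrary A
  obtain ⟨hB, x, hx, hxn⟩ := exists_feature_norm hH hφ hG hθ (x₁, a, a)
  have h1 := log_one_add_le_effDim (T := T) hl hφ hx
  have h2 : (H / B) ^ 2 ≤ ‖x‖ ^ 2 := pow_le_pow_left₀ (by positivity) hxn 2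
  have h3 : Real.log (1 + T * (lam⁻¹ * (H / B) ^ 2)) ≤ Real.log (1 + T * (lam⁻¹ * ‖x‖ ^ 2)) :=
    Real.log_le_log (by positivity) (by gcongr)
  have h4 := quarter_min_le_of_log_le (H := (H : ℝ)) (T := T) (Γ := effDim φ H T lam)
    (by exact_mod_cast hT) hlam hB (by linarith)
  have h5 : 0 < min 1 (T * (H : ℝ) ^ 2 / (2 * B ^ 2)) := lt_min one_pos (by positivity)
  exact ⟨hB, by linarith, h4⟩

/-- The `2 H` confidence failures have probability at most `(δ / H)² / e` each, in total at most `3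
δ / 4`; the concentration of the bonuses takes the remaining `δ / 4`. -/
lemma failure_budget_le (hH : 1 ≤ H) (hδ : 0 < δ) (hδ1 : δ < 1) :
    2 * (H : ℝ) * Real.exp (-(1 + 2 * Real.log (H / δ))) + Real.exp (-Real.log (4 / δ)) ≤ δ := by
  have hH1 : (1 : ℝ) ≤ H := by exact_mod_cast hH
  have hH0 : (0 : ℝ) < H := by linarith
  have h1 : Real.exp (-Real.log (4 / δ)) = δ / 4 := by
    rw [Real.exp_neg, Real.exp_log (by positivity), inv_div]
  have h2 : Real.exp (-(1 + 2 * Real.log (H / δ))) = (Real.exp 1)⁻¹ * (δ / H) ^ 2 := by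
    rw [neg_add, Real.exp_add, Real.exp_neg, ← mul_neg, ← Real.log_inv, inv_div, mul_comm 2,
      Real.exp_mul, Real.exp_log (by positivity)]
    norm_num
  have h3 : (Real.exp 1)⁻¹ ≤ 3 / 8 := by
    rw [inv_le_comm₀ (Real.exp_pos _) (by norm_num)]
    linarith [Real.exp_one_gt_d9]
  have h4 : 2 * (H : ℝ) * (δ / H) ^ 2 ≤ 2 * δ := by
    have : 2 * (H : ℝ) * (δ / H) ^ 2 = 2 * δ * (δ / H) := by field_simp
    rw [this]
    exact mul_le_of_le_one_right (by linarith) ((div_le_one hH0).2 (by linarith))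
  have h5 : 2 * (H : ℝ) * ((Real.exp 1)⁻¹ * (δ / H) ^ 2) ≤ 3 / 8 * (2 * δ) := by
    rw [show 2 * (H : ℝ) * ((Real.exp 1)⁻¹ * (δ / H) ^ 2) =
      (Real.exp 1)⁻¹ * (2 * (H : ℝ) * (δ / H) ^ 2) by ring]
    exact mul_le_mul h3 h4 (by positivity) (by norm_num)
  rw [h1, h2]
  linarith

/-- The policies of the episodes of minimal estimated gap form an approximate Nash equilibrium with
high probability. -/
theorem le_toOuterMeasure_successEvent (F : CCERoutine S A) (x₁ : S) {β ε : ℝ} (hH : 1 ≤ H)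
    (hT : 1 ≤ T) (hδ : 0 < δ) (hε : 0 < ε) (hβ : 0 < β) (hlam : lam = 1 + 1 / (T : ℝ))
    (hφ : NormalizedFeature φ) (hG : IsKernelMixture G φ θ) (hθ : ∀ h, ‖θ h‖ ≤ B)
    (hF : F.Correct) (hL : bonusLevel φ H T lam B δ ≤ (β / H) ^ 2)
    (hC : 1024 * (β ^ 2 * (H : ℝ) ^ 2 * effDim φ H T lam / ε ^ 2) ≤ T) :
    ENNReal.ofReal (1 - δ) ≤
      (runLaw ⟨G.reward, φ, lam, β, F⟩ G.trans x₁ T).toOuterMeasure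
        (successEvent ⟨G.reward, φ, lam, β, F⟩ G x₁ T ε) := by
  rcases le_or_gt 1 δ with hδ1 | hδ1
  · rw [ENNReal.ofReal_of_nonpos (by linarith)]; exact zero_le
  have hH1 : (1 : ℝ) ≤ H := by exact_mod_cast hH
  have hT1 : (1 : ℝ) ≤ T := by exact_mod_cast hT
  have hl : 0 < lam := by rw [hlam]; positivity
  obtain ⟨hB, hΓ0, hΓ⟩ := exists_effDim_lower_bound hH hT hlam hφ hG hθ x₁
  have hlogpos : 0 ≤ Real.log (H / δ) :=
    Real.log_nonneg (by rw [le_div_iff₀ hδ]; linarith)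
  rw [bonusLevel] at hL
  have hBH : 0 ≤ lam * (B / H) ^ 2 := by positivity
  -- The summand 2 alone puts the bonus level above one.
  have hβH : (H : ℝ) ≤ β := by
    have h1 : (1 : ℝ) ^ 2 ≤ (β / H) ^ 2 := by linarith
    have h2 := (abs_le_of_sq_le_sq' h1 (by positivity)).2
    rwa [one_le_div (by linarith)] at h2
  set I : AlgInput S A E H := ⟨G.reward, φ, lam, β, F⟩ with hI
  let a : A := Classical.arbitrary A
  have hpacc := accuracy_trivial_or_le hH1 hT1 hδ hδ1 hε hβ hlam hB hΓ0 hΓ hL hC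
  set p := runLaw I G.trans x₁ T with hp
  -- Chosen so that `2 c` is the term `2 + 4 log (H / δ)` of the bonus level.
  set c := 1 + 2 * Real.log (H / δ) with hc
  let bad (est : Record S A H → Fin (H + 1) → S → ℝ) (h : Fin H) : Set (List (Episode S A H)) :=
    {run | run.length = T ∧ ∃ past, past <:+ run ∧
      θ h ∉ confidenceSet I.lam I.β (pastData I est h past)}
  let worse : Set (List (Episode S A H)) := {run | 2 * runSum (episodeBonus I) run +
    4 * (H : ℝ) ^ 2 * Real.log (4 / δ) ≤ runSum (fun past _ => meanBonus I G x₁ past) run}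
  have hcov : p.support ⊆ successEvent I G x₁ T ε ∪
      ((⋃ h, (bad Record.upper h ∪ bad Record.lower h)) ∪ worse) := by
    intro run hrun
    have hlen : run.length = T := length_of_mem_support_runLaw hrun
    by_contra hnot
    simp only [Set.mem_union, Set.mem_iUnion, not_or, not_exists] at hnot
    obtain ⟨hs, hbad, hworse⟩ := hnot
    apply hs
    intro t₀ ht₀ hmin
    rcases hpacc with htriv | hacc
    · exact isApproxNash_of_two_mul_le G htriv _ _ _
    have hgood : ∀ past, past <:+ run → AllConfident I θ past := by
      intro past hpast h
      refine ⟨?_, ?_⟩ <;> by_contra hcon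
      · exact (hbad h).1 ⟨hlen, past, hpast, hcon⟩
      · exact (hbad h).2 ⟨hlen, past, hpast, hcon⟩
    have hsum := runSum_episodeBonus_le (I := I) hl hβH hφ (run := run) (by omega) (x₁, a, a)
      (by rw [hlen]; exact hΓ0)
    rw [hlen] at hsum
    have hmean : runSum (fun past _ => meanBonus I G x₁ past) run <
        2 * runSum (episodeBonus I) run + 4 * (H : ℝ) ^ 2 * Real.log (4 / δ) := not_le.1 hworse
    have hgap := length_mul_le_of_le_estimatedGap (I := I) (x₁ := x₁) hl hβ.le hφ hG hgood
      (g := estimatedGap I x₁ run t₀) (fun t ht => hmin t (hlen ▸ ht))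
    rw [hlen] at hgap
    have hsum' : runSum (episodeBonus I) run ≤ 8 * β * H * √(T * effDim φ H T lam) := hsum
    -- The minimal gap is at most the average of the mean bonuses, which are at most twice the
    -- collected bonuses plus `4 H² log (4 / δ)` in total.
    have hle : T * estimatedGap I x₁ run t₀ ≤ T * ε := by linarith
    exact isApproxNash_of_gap_le (I := I) hl hβ.le hφ hG rfl hF (hgood _ (List.drop_suffix _ _))
      (le_of_mul_le_mul_left hle (by linarith))
  have hconf : ∀ (est : Record S A H → Fin (H + 1) → S → ℝ)
      (V : List (Episode S A H) → Fin (H + 1) → S → ℝ), IsEstimate I est V → ∀ h,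
      p.toOuterMeasure (bad est h) ≤ ENNReal.ofReal (Real.exp (-c)) := fun est V hV h =>
    toOuterMeasure_notMem_confidenceSet_le (I := I) hH hl hβ.le hφ hG hθ hV h x₁ (x₁, a, a) T
      (show 2 * effDim φ H T lam + 2 * c + lam * (B / H) ^ 2 ≤ (β / H) ^ 2 by linarith)
  have hworse : p.toOuterMeasure worse ≤ ENNReal.ofReal (Real.exp (-Real.log (4 / δ))) :=
    toOuterMeasure_meanBonus_le hH hβ.le T _
  have hrest : p.toOuterMeasure ((⋃ h, (bad Record.upper h ∪ bad Record.lower h)) ∪ worse) ≤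
      ENNReal.ofReal δ := by
    refine le_trans ?_ (ENNReal.ofReal_le_ofReal (failure_budget_le hH hδ hδ1))
    rw [ENNReal.ofReal_add (by positivity) (Real.exp_pos _).le]
    refine (MeasureTheory.measure_union_le _ _).trans (add_le_add ?_ hworse)
    refine (MeasureTheory.measure_iUnion_fintype_le _ _).trans ?_
    have hh : ∀ h, p.toOuterMeasure (bad Record.upper h ∪ bad Record.lower h) ≤
        ENNReal.ofReal (2 * Real.exp (-c)) := fun h => by
      rw [two_mul, ENNReal.ofReal_add (Real.exp_pos _).le (Real.exp_pos _).le]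
      exact (MeasureTheory.measure_union_le _ _).trans (add_le_add
        (hconf _ _ (isEstimate_upper I) h) (hconf _ _ (isEstimate_lower I) h))
    refine (Finset.sum_le_sum fun h _ => hh h).trans (le_of_eq ?_)
    rw [Finset.sum_const, Finset.card_univ, Fintype.card_fin, nsmul_eq_mul,
      ← ENNReal.ofReal_natCast H, ← ENNReal.ofReal_mul (by positivity)]
    congr 1
    ring
  -- The support is covered by success and the failure events, so subadditivity gives the bound
  -- without measurability.
  have hone := (p.toOuterMeasure_apply_eq_one_iff _).2 hcov
  rw [ENNReal.ofReal_sub _ hδ.le, ENNReal.ofReal_one, tsub_le_iff_right, ← hone]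
  exact (MeasureTheory.measure_union_le _ _).trans (by gcongr)

end Main

end KernelGame

end

theorem mainTheorem7 :
    (∃ C : ℝ, 0 < C ∧
      ∀ (S A E : Type*) [Fintype A] [Nonempty A]
        [NormedAddCommGroup E] [InnerProductSpace ℝ E] [CompleteSpace E]
        (H T : ℕ) (G : KernelGame.MarkovGame S A H) (φ : S × A × A → S → E) (θ : Fin H → E)
        (F : KernelGame.CCERoutine S A) (x₁ : S) (B β δ ε lam : ℝ),
        1 ≤ H → 1 ≤ T → 0 < δ → 0 < ε → 0 < β → lam = 1 + 1 / (T : ℝ) →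
        KernelGame.NormalizedFeature φ → KernelGame.IsKernelMixture G φ θ →
        (∀ h, ‖θ h‖ ≤ B) → F.Correct →
        KernelGame.bonusLevel φ H T lam B δ ≤ (β / H) ^ 2 →
        C * (β ^ 2 * (H : ℝ) ^ 2 * KernelGame.effDim φ H T lam / ε ^ 2) ≤ T →
        ENNReal.ofReal (1 - δ) ≤
          (KernelGame.runLaw ⟨G.reward, φ, lam, β, F⟩ G.trans x₁ T).toOuterMeasure
            (KernelGame.successEvent ⟨G.reward, φ, lam, β, F⟩ G x₁ T ε)) ∧
    (∀ B : ℝ, ∃ C : ℝ, 0 < C ∧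
      ∀ (S A E : Type*) [Fintype A] [Nonempty A]
        [NormedAddCommGroup E] [InnerProductSpace ℝ E] [CompleteSpace E]
        (H T : ℕ) (G : KernelGame.MarkovGame S A H) (φ : S × A × A → S → E) (θ : Fin H → E)
        (F : KernelGame.CCERoutine S A) (x₁ : S) (β δ ε lam : ℝ),
        1 ≤ H → 1 ≤ T → 0 < δ → 0 < ε → 0 < β → lam = 1 + 1 / (T : ℝ) →
        KernelGame.NormalizedFeature φ → KernelGame.IsKernelMixture G φ θ →
        (∀ h, ‖θ h‖ ≤ B) → F.Correct →
        (β / H) ^ 2 = KernelGame.bonusLevel φ H T lam B δ →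
        C * ((1 + Real.log (H / δ)) *
          ((H : ℝ) ^ 4 * KernelGame.effDim φ H T lam ^ 2 / ε ^ 2)) ≤ T →
        ENNReal.ofReal (1 - δ) ≤
          (KernelGame.runLaw ⟨G.reward, φ, lam, β, F⟩ G.trans x₁ T).toOuterMeasure
            (KernelGame.successEvent ⟨G.reward, φ, lam, β, F⟩ G x₁ T ε)) := by
  refine ⟨⟨1024, by norm_num, ?_⟩, fun B => ?_⟩
  · intro S A E _ _ _ _ _ H T G φ θ F x₁ B β δ ε lam hH hT hδ hε hβ hlam hφ hG hθ hF hL hC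
    exact KernelGame.le_toOuterMeasure_successEvent F x₁ hH hT hδ hε hβ hlam hφ hG hθ hF hL hC
  -- The constant of the first part times that of `bonusLevel_bound`: with `β² = H² L`, the first
  -- requirement on `T` follows from the second.
  · refine ⟨1024 * (2 + (4 + 4 * B ^ 2) * (4 * (2 * B ^ 2 + 1))), by positivity, ?_⟩
    intro S A E _ _ _ _ _ H T G φ θ F x₁ β δ ε lam hH hT hδ hε hβ hlam hφ hG hθ hF hL hC
    rcases le_or_gt 1 δ with hδ1 | hδ1
    · rw [ENNReal.ofReal_of_nonpos (by linarith)]; exact zero_le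
    have hH1 : (1 : ℝ) ≤ H := by exact_mod_cast hH
    have hT1 : (1 : ℝ) ≤ T := by exact_mod_cast hT
    obtain ⟨hB, hΓ0, hΓ⟩ := KernelGame.exists_effDim_lower_bound hH hT hlam hφ hG hθ x₁
    refine KernelGame.le_toOuterMeasure_successEvent F x₁ hH hT hδ hε hβ hlam hφ hG hθ hF hL.ge
      (le_trans ?_ hC)
    have h1 := KernelGame.bonusLevel_bound hH1 hT1 hδ hδ1 hlam hB hΓ
    have h2 : (β / H) ^ 2 ≤ _ := hL.le.trans h1
    rw [div_pow, div_le_iff₀ (by positivity)] at h2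
    have h3 := mul_le_mul_of_nonneg_right h2
      (by positivity : 0 ≤ (H : ℝ) ^ 2 * KernelGame.effDim φ H T lam / ε ^ 2)
    refine le_trans (le_of_eq ?_) ((mul_le_mul_of_nonneg_left h3
      (by norm_num : (0 : ℝ) ≤ 1024)).trans (le_of_eq ?_)) <;> ring
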